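/- **Theorem (Renegar's condition number).** For a closed convex cone $C\subseteq\mathbb{R}^m$ let $\Pi_C$ denote the Euclidean projection onto $C$, and let $\delta(C)=\mathbb{E}\,\|\Pi_C(g)\|^2$, $g\sim N(0,I_m)$, be its statistical dimension. For nonzero closed convex cones $C\subseteq\mathbb{R}^m$, $D\subseteq\mathbb{R}^n$ and $A\in\mathbb{R}^{n\times m}$ put $$\sigma_{C\to D}(A)=\min_{x\in C,\ \|x\|=1}\|\Pi_D(Ax)\|,\qquad \mathcal{R}_{C,D}(A)=\min\Big\{\frac{\|A\|}{\sigma_{C\to D}(A)},\ \frac{\|A\|}{\sigma_{D\to C}(-A^T)}\Big\}\in[0,\infty],$$ where $\|A\|$ is the Euclidean operator norm and a quotient with denominator $0$ has the value $\infty$. A Gaussian matrix is a random matrix with independent standard normal entries. Let $0<\alpha,\beta,\gamma\le 1$ with $\beta>\alpha\gamma$, and for $k\in\mathbb{N}$ let $C_k\subseteq\mathbb{R}^{m_k}$, $D_k\subseteq\mathbb{R}^{n_k}$ be nonzero closed convex cones such that, as $k\to\infty$, $$\frac{\delta(C_k)}{m_k}\to\alpha^2,\qquad \frac{\delta(D_k)}{n_k}\to\beta^2,\qquad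 \frac{m_k}{n_k}\to\gamma^2,\qquad n_k\to\infty .$$ Let $G_k\in\mathbb{R}^{n_k\times m_k}$ be a Gaussian matrix. Then there exist measurable sets $E_k\subseteq\mathbb{R}^{n_k\times m_k}$, a constant $c>0$ and real numbers $u_k$ such that for all $k$ $$\mathbb{P}\{G_k\in E_k\}\le e^{-c\,n_k},\qquad \mathbb{E}\big[\mathcal{R}_{C_k,D_k}(G_k)\,\big|\,G_k\notin E_k\big]<u_k,\qquad\text{and}\qquad u_k\to\frac{1+\gamma}{\beta-\alpha\gamma}\quad(k\to\infty).$$ In particular, if $n_k=\Omega(k)$, then the weak average-case complexity of $\mathcal{R}_{C_k,D_k}$ is constant, that is, $\mathcal{R}_{C_k,D_k}$ is almost everywhere measurable with respect to the law of $G_k$, and there are measurable sets $E_k\subseteq\mathbb{R}^{n_k\times m_k}$ with $\mathbb{P}\{G_k\in E_k\}<1$ for all $k$ and $\mathbb{P}\{G_k\in E_k\}=e^{-\Omega(k)}$, and a constant $K$ such that $\mathbb{E}[\mathcal{R}_{C_k,D_k}(G_k)\mid G_k\notin E_k]\le K$ for all $k$. -/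

import Mathlib

open MeasureTheory ProbabilityTheory Filter Topology
open scoped ENNReal

noncomputable section

/-- Euclidean space `ℝᵈ`. -/
abbrev Euc (d : ℕ) : Type := EuclideanSpace ℝ (Fin d)

/-- A closed convex cone in `ℝᵈ`. Mathlib's `ProperCone` asks for a closed set that contains `0`
and is stable under addition and under multiplication by nonnegative scalars; subspaces and the
whole space are included. -/
abbrev ClosedConvexCone (d : ℕ) : Type := ProperCone ℝ (Euc d)

/-- Every point of `ℝᵈ` has a nearest point in a closed convex cone. -/
theorem ClosedConvexCone.exists_nearest {d : ℕ} (C : ClosedConvexCone d) (y : Euc d) :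
    ∃ p ∈ C, ∀ z ∈ C, ‖y - p‖ ≤ ‖y - z‖ := by
  obtain ⟨p, hp, h⟩ := exists_norm_eq_iInf_of_complete_convex (K := (C : Set (Euc d)))
    C.nonempty C.isClosed.isComplete C.convex y
  refine ⟨p, hp, fun z hz => h.trans_le ?_⟩
  exact ciInf_le (f := fun w : (C : Set (Euc d)) => ‖y - w‖)
    ⟨0, by rintro _ ⟨w, rfl⟩; exact norm_nonneg _⟩ ⟨z, hz⟩

/-- The Euclidean projection `Π_C(y)`: the (unique) point of `C` nearest to `y`. -/
def coneProj {d : ℕ} (C : ClosedConvexCone d) (y : Euc d) : Euc d :=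
  (C.exists_nearest y).choose

/-- The statistical dimension `δ(C) = 𝔼 ‖Π_C(g)‖²`, with `g` a standard Gaussian vector. -/
def statDim {d : ℕ} (C : ClosedConvexCone d) : ℝ :=
  ∫ g, ‖coneProj C g‖ ^ 2 ∂(stdGaussian (Euc d))

/-- Real matrices carry the product `σ`-algebra. -/
instance matrixMeasurableSpace (n m : ℕ) : MeasurableSpace (Matrix (Fin n) (Fin m) ℝ) :=
  inferInstanceAs (MeasurableSpace (Fin n → Fin m → ℝ))

/-- The law of the Gaussian matrix `G ∈ ℝ^{n×m}`: independent standard normal entries. -/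
def gaussianMatrix (n m : ℕ) : Measure (Matrix (Fin n) (Fin m) ℝ) :=
  Measure.pi (fun _ : Fin n => Measure.pi (fun _ : Fin m => gaussianReal 0 1))

/-- The operator norm of a matrix with respect to the Euclidean norms. -/
def matOpNorm {n m : ℕ} (A : Matrix (Fin n) (Fin m) ℝ) : ℝ :=
  ‖LinearMap.toContinuousLinearMap (Matrix.toEuclideanLin A)‖

/-- The smallest restricted singular value
`σ_{C→D}(A) = min {‖Π_D(A x)‖ : x ∈ C, ‖x‖ = 1}`. -/
def sres {n m : ℕ} (A : Matrix (Fin n) (Fin m) ℝ) (C : ClosedConvexCone m)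
    (D : ClosedConvexCone n) : ℝ :=
  ⨅ x : {x : Euc m // x ∈ C ∧ ‖x‖ = 1}, ‖coneProj D (Matrix.toEuclideanLin A x)‖

/-- The quotient `a / s` in `[0, ∞]` of nonnegative reals, equal to `∞` when `s = 0`. -/
def extRatio (a s : ℝ) : ℝ≥0∞ := if s = 0 then ∞ else ENNReal.ofReal (a / s)

/-- The biconic Renegar condition number
`R_{C,D}(A) = min {‖A‖ / σ_{C→D}(A), ‖A‖ / σ_{D→C}(-Aᵀ)}`, with values in `[0, ∞]`. -/
def renegarCond {n m : ℕ} (C : ClosedConvexCone m) (D : ClosedConvexCone n)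
    (A : Matrix (Fin n) (Fin m) ℝ) : ℝ≥0∞ :=
  min (extRatio (matOpNorm A) (sres A C D)) (extRatio (matOpNorm A) (sres (-A.transpose) D C))

/-- The conditional expectation `𝔼[T(x) ∣ x ∉ E]` of a nonnegative `T` under `μ`. -/
def condExpOff {M : Type*} [MeasurableSpace M] (μ : Measure M) (T : M → ℝ≥0∞) (E : Set M) :
    ℝ≥0∞ :=
  ∫⁻ x, T x ∂(cond μ Eᶜ)

/-- The family of nonnegative measurable functions `T k` on the probability spaces `(M k, μ k)`
has weak expectation `O(f(k))`: there are exceptional sets `E k` of measure `e^{-Ω(k)}`, none of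
full measure, off which the conditional expectation of `T k` is at most a constant times `f k`. -/
def HasWeakExpectation {M : ℕ → Type*} [∀ k, MeasurableSpace (M k)] (μ : ∀ k, Measure (M k))
    (T : ∀ k, M k → ℝ≥0∞) (f : ℕ → ℝ) : Prop :=
  (∀ k, AEMeasurable (T k) (μ k)) ∧
  ∃ E : ∀ k, Set (M k),
    (∀ k, MeasurableSet (E k) ∧ μ k (E k) < 1) ∧
    (∃ c : ℝ, 0 < c ∧ ∀ᶠ k : ℕ in atTop, μ k (E k) ≤ ENNReal.ofReal (Real.exp (-(c * k)))) ∧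
    ∃ K : ℝ, 0 < K ∧ ∀ k, condExpOff (μ k) (T k) (E k) ≤ ENNReal.ofReal (K * f k)

end

/-! ### Rotations of Gaussian pairs and integration by parts -/

section GaussianTools

open Real

/-! Only the first quotient in the condition number matters asymptotically. Off an event of
probability `exp (-c n)`, the norm of `G` is at most `(1 + γ + ε) √n` and `sres G C D` is at least
`(β - α γ - ε) √n`, so the quotient is at most `(1 + γ + ε) / (β - α γ - ε)`.

Both estimates (`gaussianMatrix_sres_le`, `gaussianMatrix_lt_matOpNorm`) come from Gordon's
comparison. Since `‖Π_D v‖` is the largest `⟪v, y⟫` over the unit ball of `D`, the restricted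
singular value is a min-max of the process `⟪G x, y⟫`. It is compared with `⟪h, y⟫ - ⟪g, x⟫`, whose
min-max has mean about `𝔼 ‖Π_D h‖ - 𝔼 ‖Π_C g‖`. A dimension-free variance bound (`sqrt_statDim_le`)
makes this `√δ(D) - √δ(C)` up to a constant, and Maurey–Pisier concentration turns the mean into a
tail. The cones are replaced by finite nets and the min-max by the smooth function `softMinMax`, so
that comparison and concentration reduce to calculus and to the rotation invariance of a pair of
Gaussian vectors.

The exceptional sets are fixed once, with coarse constants that keep the condition number bounded
off them. For each smaller `ε`, the finer bad event has exponentially small probability and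
contributes negligibly to the conditional expectation (`condExpOff_le_add`), which gives the sharp
limit. For the finitely many remaining `k`, it suffices that the condition number is bounded on some
nonempty open set of matrices. This follows from an explicit well-conditioned matrix
(`exists_sres_pos`), built by comparing the lineality spaces of the two cones. -/

theorem hasDerivAt_integral_comp_rotation {E V : Type*} [NormedAddCommGroup E] [NormedSpace ℝ E]
    [MeasurableSpace E] [BorelSpace E] [SecondCountableTopology E]
    [NormedAddCommGroup V] [NormedSpace ℝ V]
    {μ : Measure E} [IsProbabilityMeasure μ] (hμ : MemLp id 2 μ)
    {H : V → ℝ} {H' : V → V →L[ℝ] ℝ} (hH : ∀ z, HasFDerivAt H (H' z) z) (hH' : Continuous H')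
    {K : ℝ} (hK : ∀ z, ‖H' z‖ ≤ K * (1 + ‖z‖)) (A B : E →L[ℝ] V) (θ : ℝ) :
    Integrable (fun ω => H (cos θ • A ω + sin θ • B ω)) μ ∧
    Integrable (fun ω => H' (cos θ • A ω + sin θ • B ω) (-sin θ • A ω + cos θ • B ω)) μ ∧
    HasDerivAt (fun θ => ∫ ω, H (cos θ • A ω + sin θ • B ω) ∂μ)
      (∫ ω, H' (cos θ • A ω + sin θ • B ω) (-sin θ • A ω + cos θ • B ω) ∂μ) θ := by
  have hHc : Continuous H := continuous_iff_continuousAt.2 fun z => (hH z).continuousAt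
  have hK0 : 0 ≤ K := by simpa using (norm_nonneg _).trans (hK 0)
  set c := ‖A‖ + ‖B‖ with hc
  have hc0 : 0 ≤ c := by positivity
  have hlin : ∀ (a b : ℝ) (ω : E), |a| ≤ 1 → |b| ≤ 1 → ‖a • A ω + b • B ω‖ ≤ c * ‖ω‖ := by
    intro a b ω ha hb
    calc ‖a • A ω + b • B ω‖ ≤ ‖a • A ω‖ + ‖b • B ω‖ := norm_add_le _ _
      _ ≤ 1 * (‖A‖ * ‖ω‖) + 1 * (‖B‖ * ‖ω‖) := by
        rw [norm_smul, norm_smul, Real.norm_eq_abs, Real.norm_eq_abs]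
        gcongr
        · exact A.le_opNorm ω
        · exact B.le_opNorm ω
      _ = c * ‖ω‖ := by rw [hc]; ring
  have i1 : Integrable (fun ω : E => ‖ω‖) μ := (hμ.integrable (by norm_num)).norm
  have i2 : Integrable (fun ω : E => ‖ω‖ ^ 2) μ := by
    simpa using hμ.integrable_norm_pow (by norm_num)
  -- A majorant of the `θ`-derivative that does not depend on `θ`; it is quadratic in `‖ω‖`, so
  -- second moments suffice.
  have hbi : Integrable (fun ω : E => K * (1 + c * ‖ω‖) * (c * ‖ω‖)) μ := by
    have : (fun ω : E => K * (1 + c * ‖ω‖) * (c * ‖ω‖)) =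
        fun ω => (K * c) * ‖ω‖ + (K * c ^ 2) * ‖ω‖ ^ 2 := by ext; ring
    rw [this]
    exact (i1.const_mul _).add (i2.const_mul _)
  have hbd : ∀ z, ‖H z‖ ≤ ‖H 0‖ + K * (1 + ‖z‖) * ‖z‖ := by
    intro z
    have h := (convex_closedBall (0 : V) ‖z‖).norm_image_sub_le_of_norm_hasFDerivWithin_le
      (f := H) (f' := H') (C := K * (1 + ‖z‖)) (fun x _ => (hH x).hasFDerivWithinAt)
      (fun x hx => (hK x).trans (by
        have : ‖x‖ ≤ ‖z‖ := by simpa using hx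
        gcongr)) (x := 0) (y := z) (by simp) (by simp)
    have h2 := norm_sub_norm_le (H z) (H 0)
    rw [sub_zero] at h
    linarith
  have hint : ∀ θ, Integrable (fun ω => H (cos θ • A ω + sin θ • B ω)) μ := by
    intro θ
    refine Integrable.mono' ((integrable_const ‖H 0‖).add hbi)
      (hHc.comp (by fun_prop)).aestronglyMeasurable (ae_of_all _ fun ω => ?_)
    refine (hbd _).trans ?_
    have := hlin (cos θ) (sin θ) ω (abs_cos_le_one θ) (abs_sin_le_one θ)
    simp only [Pi.add_apply]
    gcongr
  have key := hasDerivAt_integral_of_dominated_loc_of_deriv_le (μ := μ) (s := Set.univ) (x₀ := θ)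
    (F := fun θ ω => H (cos θ • A ω + sin θ • B ω))
    (F' := fun θ ω => H' (cos θ • A ω + sin θ • B ω) (-sin θ • A ω + cos θ • B ω))
    (bound := fun ω => K * (1 + c * ‖ω‖) * (c * ‖ω‖)) univ_mem
    (Eventually.of_forall fun θ => (hint θ).aestronglyMeasurable) (hint θ)
    (Continuous.aestronglyMeasurable (by fun_prop))
    (ae_of_all _ fun ω θ _ => by
      refine (ContinuousLinearMap.le_opNorm _ _).trans ?_
      have h1 := hlin (cos θ) (sin θ) ω (abs_cos_le_one θ) (abs_sin_le_one θ)
      have h2 := hlin (-sin θ) (cos θ) ω (by rw [abs_neg]; exact abs_sin_le_one θ)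
        (abs_cos_le_one θ)
      have h3 := hK (cos θ • A ω + sin θ • B ω)
      gcongr
      refine h3.trans ?_
      gcongr) hbi
    (ae_of_all _ fun ω θ _ => by
      exact (hH _).comp_hasDerivAt θ
        (((hasDerivAt_cos θ).smul_const (A ω)).add ((hasDerivAt_sin θ).smul_const (B ω))))
  exact ⟨hint θ, key⟩

variable {E : Type*} [NormedAddCommGroup E] [InnerProductSpace ℝ E] [FiniteDimensional ℝ E]
  [MeasurableSpace E] [BorelSpace E]

theorem integral_strongDual_mul_inner_stdGaussian (L : StrongDual ℝ E) (u : E) :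
    ∫ y, L y * inner ℝ u y ∂(stdGaussian E) = L u := by
  have h := covarianceBilin_apply (μ := stdGaussian E) IsGaussian.memLp_two_id
    ((InnerProductSpace.toDual ℝ E).symm L) u
  rw [covarianceBilin_stdGaussian] at h
  have e : (innerSL ℝ) ((InnerProductSpace.toDual ℝ E).symm L) u = L u :=
    InnerProductSpace.toDual_symm_apply
  rw [e] at h
  simpa using h.symm

theorem stdGaussian_prod_map_rotation (θ : ℝ) :
    ((stdGaussian E).prod (stdGaussian E)).map (ContinuousLinearMap.rotation θ) =
      (stdGaussian E).prod (stdGaussian E) :=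
  IsGaussian.map_rotation_eq_self (by simp) θ

/-- Gaussian integration by parts. -/
theorem integral_inner_mul_stdGaussian {h : E → ℝ} {h' : E → E →L[ℝ] ℝ}
    (hh : ∀ x, HasFDerivAt h (h' x) x) (hh' : Continuous h') {K : ℝ}
    (hK : ∀ x, |h x| ≤ K) (hK' : ∀ x, ‖h' x‖ ≤ K) (u : E) :
    ∫ x, inner ℝ u x * h x ∂(stdGaussian E) = ∫ x, h' x u ∂(stdGaussian E) := by
  set μ := stdGaussian E
  have hc : Continuous h := continuous_iff_continuousAt.2 fun z => (hh z).continuousAt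
  have hK0 : 0 ≤ K := (abs_nonneg _).trans (hK 0)
  -- For an independent pair, the mean of `H` is constant along the rotation `(x, y) ↦ cos θ (x, y)
  -- + sin θ (y, -x)`. Its derivative at `0` is the mean of `h' x y * ⟪u, y⟫ - ⟪u, x⟫ * h x`, and
  -- integrating out `y` turns the first term into `h' x u`.
  let H : E × E → ℝ := fun p => h p.1 * inner ℝ u p.2
  let H' : E × E → (E × E →L[ℝ] ℝ) := fun p =>
    h p.1 • ((innerSL ℝ u).comp (ContinuousLinearMap.snd ℝ E E)) +
      (inner ℝ u p.2 : ℝ) • ((h' p.1).comp (ContinuousLinearMap.fst ℝ E E))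
  have hH : ∀ p, HasFDerivAt H (H' p) p := by
    intro p
    have h1 : HasFDerivAt (fun p : E × E => h p.1)
      ((h' p.1).comp (ContinuousLinearMap.fst ℝ E E)) p :=
      (hh p.1).comp p hasFDerivAt_fst
    have h2 : HasFDerivAt (fun p : E × E => (inner ℝ u p.2 : ℝ))
      ((innerSL ℝ u).comp (ContinuousLinearMap.snd ℝ E E)) p :=
      ((innerSL ℝ u).comp (ContinuousLinearMap.snd ℝ E E)).hasFDerivAt
    exact h1.mul h2
  have hHc : Continuous H' := by
    have := hh'.comp (continuous_fst (X := E) (Y := E))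
    simp only [H']
    fun_prop
  have hbd : ∀ p, ‖H' p‖ ≤ (K * ‖u‖) * (1 + ‖p‖) := by
    intro p
    refine ContinuousLinearMap.opNorm_le_bound _ (by positivity) fun q => ?_
    have e1 : |inner ℝ u q.2| ≤ ‖u‖ * ‖q‖ :=
      (abs_real_inner_le_norm u q.2).trans (by gcongr; exact norm_snd_le q)
    have e2 : |h' p.1 q.1| ≤ K * ‖q‖ :=
      ((h' p.1).le_opNorm q.1).trans (by
        have := hK' p.1
        gcongr
        exact norm_fst_le q)
    have e3 : |inner ℝ u p.2| ≤ ‖u‖ * ‖p‖ :=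
      (abs_real_inner_le_norm u p.2).trans (by gcongr; exact norm_snd_le p)
    have e4 := hK p.1
    change |h p.1 * inner ℝ u q.2 + inner ℝ u p.2 * h' p.1 q.1| ≤ _
    calc _ ≤ |h p.1| * |inner ℝ u q.2| + |inner ℝ u p.2| * |h' p.1 q.1| := by
          rw [← abs_mul, ← abs_mul]
          exact abs_add_le _ _
      _ ≤ K * (‖u‖ * ‖q‖) + (‖u‖ * ‖p‖) * (K * ‖q‖) := by gcongr
      _ = _ := by ring
  obtain ⟨-, hi, hd⟩ := hasDerivAt_integral_comp_rotation (μ := μ.prod μ)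
    IsGaussian.memLp_two_id hH hHc hbd (ContinuousLinearMap.id ℝ (E × E))
    ((ContinuousLinearMap.snd ℝ E E).prod (-(ContinuousLinearMap.fst ℝ E E))) 0
  have hconst : (fun θ : ℝ => ∫ ω, H (cos θ • (ContinuousLinearMap.id ℝ (E × E)) ω +
      sin θ • ((ContinuousLinearMap.snd ℝ E E).prod (-(ContinuousLinearMap.fst ℝ E E))) ω)
      ∂(μ.prod μ)) = fun _ => ∫ ω, H ω ∂(μ.prod μ) := by
    ext θ
    conv_rhs => rw [← stdGaussian_prod_map_rotation θ]
    rw [integral_map (by fun_prop)]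
    · congr 1
      ext ω
      simp only [ContinuousLinearMap.rotation_apply]
      congr 1
      ext <;> simp [add_comm]
    · exact Continuous.aestronglyMeasurable
        (continuous_iff_continuousAt.2 fun z => (hH z).continuousAt)
  rw [hconst] at hd
  have h0 := hd.unique (hasDerivAt_const _ _)
  have hsplit : ∀ ω : E × E, H' (cos 0 • (ContinuousLinearMap.id ℝ (E × E)) ω +
      sin 0 • ((ContinuousLinearMap.snd ℝ E E).prod (-(ContinuousLinearMap.fst ℝ E E))) ω)
      (-sin 0 • (ContinuousLinearMap.id ℝ (E × E)) ω +
      cos 0 • ((ContinuousLinearMap.snd ℝ E E).prod (-(ContinuousLinearMap.fst ℝ E E))) ω) =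
      h' ω.1 ω.2 * inner ℝ u ω.2 - inner ℝ u ω.1 * h ω.1 := by
    intro ω
    simp [H']
    ring
  simp_rw [hsplit] at h0 hi
  have i1 : Integrable (fun x : E => inner ℝ u x * h x) μ := by
    refine Integrable.mul_bdd (c := K) ?_ hc.aestronglyMeasurable (ae_of_all _ hK)
    exact (IsGaussian.integrable_dual μ (innerSL ℝ u))
  have i2 : Integrable (fun ω : E × E => inner ℝ u ω.1 * h ω.1) (μ.prod μ) := i1.comp_fst μ
  have i3 : Integrable (fun ω : E × E => h' ω.1 ω.2 * inner ℝ u ω.2) (μ.prod μ) := by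
    refine (hi.add i2).congr (ae_of_all _ fun ω => ?_)
    simp
  rw [integral_sub i3 i2, integral_prod _ i3, integral_prod _ i2] at h0
  simp only [integral_strongDual_mul_inner_stdGaussian, integral_const, probReal_univ,
    one_smul, μ] at h0
  linarith

end GaussianTools

/-! ### Gaussian concentration for smooth Lipschitz functions -/

section GaussianConcentration

open Real

variable {E : Type*} [NormedAddCommGroup E] [InnerProductSpace ℝ E] [FiniteDimensional ℝ E]
  [MeasurableSpace E] [BorelSpace E]

theorem lintegral_exp_strongDual_stdGaussian (L : StrongDual ℝ E) :
    ∫⁻ y, ENNReal.ofReal (exp (L y)) ∂(stdGaussian E) = ENNReal.ofReal (exp (‖L‖ ^ 2 / 2)) := by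
  have hmap : (stdGaussian E).map L = gaussianReal 0 (‖L‖ ^ 2).toNNReal := by
    rw [IsGaussian.map_eq_gaussianReal, integral_strongDual_stdGaussian, variance_dual_stdGaussian]
  have hi : Integrable (fun y => exp (L y)) (stdGaussian E) := by
    have h := integrable_exp_mul_gaussianReal (μ := 0) (v := (‖L‖ ^ 2).toNNReal) 1
    rw [← hmap, integrable_map_measure (by fun_prop) (by fun_prop)] at h
    simpa [Function.comp_def] using h
  rw [← ofReal_integral_eq_lintegral_ofReal hi (ae_of_all _ fun _ => (exp_pos _).le)]
  have h2 := mgf_gaussianReal hmap 1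
  simp only [mgf, one_mul] at h2
  rw [h2]
  congr 2
  rw [Real.coe_toNNReal _ (by positivity)]
  ring

theorem ofReal_integral_le_lintegral {α : Type*} [MeasurableSpace α]
    {μ : Measure α} {f : α → ℝ} (hf : Integrable f μ) :
    ENNReal.ofReal (∫ x, f x ∂μ) ≤ ∫⁻ x, ENNReal.ofReal (f x) ∂μ := by
  have h := ofReal_integral_eq_lintegral_ofReal hf.pos_part (ae_of_all _ fun x => le_max_right _ _)
  calc ENNReal.ofReal (∫ x, f x ∂μ) ≤ ENNReal.ofReal (∫ x, max (f x) 0 ∂μ) :=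
        ENNReal.ofReal_le_ofReal (integral_mono hf hf.pos_part fun x => le_max_left _ _)
    _ = ∫⁻ x, ENNReal.ofReal (f x) ∂μ := by
        rw [h]
        congr 1
        ext x
        rcases le_total (f x) 0 with h | h <;> simp [h]

/-- The Maurey–Pisier inequality. -/
theorem lintegral_exp_sub_stdGaussian_le {f : E → ℝ} {f' : E → E →L[ℝ] ℝ}
    (hf : ∀ x, HasFDerivAt f (f' x) x) (hf' : Continuous f') {K : ℝ} (hK : ∀ x, ‖f' x‖ ≤ K) :
    ∫⁻ p, ENNReal.ofReal (exp (f p.2 - f p.1)) ∂((stdGaussian E).prod (stdGaussian E)) ≤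
      ENNReal.ofReal (exp (π ^ 2 * K ^ 2 / 8)) := by
  set μ := stdGaussian E
  have hfc : Continuous f := continuous_iff_continuousAt.2 fun z => (hf z).continuousAt
  let g : E × E → ℝ := fun p => f' p.1 p.2
  have hg : Continuous g := by
    have := hf'.comp (continuous_fst (X := E) (Y := E))
    exact this.clm_apply continuous_snd
  have hrot : Continuous fun q : ℝ × (E × E) => g (ContinuousLinearMap.rotation q.1 q.2) := by
    have h1 : (fun q : ℝ × (E × E) => g (ContinuousLinearMap.rotation q.1 q.2)) = fun q =>
        f' (cos q.1 • q.2.1 + sin q.1 • q.2.2) (-sin q.1 • q.2.1 + cos q.1 • q.2.2) := by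
      ext q
      simp only [g, ContinuousLinearMap.rotation_apply]
    rw [h1]
    fun_prop
  have hgc : ∀ p : E × E, Continuous fun θ : ℝ => g (ContinuousLinearMap.rotation θ p) :=
    fun p => Continuous.comp (f := fun θ : ℝ => (θ, p)) hrot (by fun_prop)
  -- The quarter circle `cos θ x + sin θ y` joins `x` to `y`, and its velocity is the second
  -- component of the rotated pair.
  have hftc : ∀ p : E × E, f p.2 - f p.1 =
      ∫ θ in (0 : ℝ)..(π / 2), g (ContinuousLinearMap.rotation θ p) := by
    intro p
    have hd : ∀ θ ∈ Set.uIcc (0 : ℝ) (π / 2),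
        HasDerivAt (fun θ => f (cos θ • p.1 + sin θ • p.2))
          (g (ContinuousLinearMap.rotation θ p)) θ := by
      intro θ _
      have h := (hf (cos θ • p.1 + sin θ • p.2)).comp_hasDerivAt θ
        (((hasDerivAt_cos θ).smul_const p.1).add ((hasDerivAt_sin θ).smul_const p.2))
      simpa [g, ContinuousLinearMap.rotation_apply, Function.comp_def] using h
    rw [intervalIntegral.integral_eq_sub_of_hasDerivAt hd]
    · simp
    · exact (hgc p).intervalIntegrable _ _
  have hpi : 0 < π / 2 := by positivity
  have hjensen : ∀ p : E × E, ENNReal.ofReal (exp (f p.2 - f p.1)) ≤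
      ∫⁻ θ in Set.Ioc (0 : ℝ) (π / 2), ENNReal.ofReal
        ((π / 2)⁻¹ * exp (π / 2 * g (ContinuousLinearMap.rotation θ p))) := by
    intro p
    have hgp := hgc p
    have hc1 : Continuous fun θ : ℝ => π / 2 * g (ContinuousLinearMap.rotation θ p) :=
      continuous_const.mul hgp
    have hi1 : IntegrableOn (fun θ : ℝ => π / 2 * g (ContinuousLinearMap.rotation θ p))
        (Set.Ioc 0 (π / 2)) :=
      (intervalIntegrable_iff_integrableOn_Ioc_of_le hpi.le).1
        (hc1.intervalIntegrable _ _)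
    have hi2 : IntegrableOn (fun θ : ℝ => exp (π / 2 * g (ContinuousLinearMap.rotation θ p)))
        (Set.Ioc 0 (π / 2)) :=
      (intervalIntegrable_iff_integrableOn_Ioc_of_le hpi.le).1
        ((continuous_exp.comp hc1).intervalIntegrable _ _)
    have hj := convexOn_exp.map_set_average_le (t := Set.Ioc (0 : ℝ) (π / 2)) (μ := volume)
      continuous_exp.continuousOn isClosed_univ (by simp [hpi]) (by simp)
      (ae_of_all _ fun _ => Set.mem_univ _) hi1 hi2
    have hvol : volume.real (Set.Ioc (0 : ℝ) (π / 2)) = π / 2 := by simp [hpi.le]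
    rw [setAverage_eq, setAverage_eq, hvol, integral_const_mul, smul_eq_mul, smul_eq_mul,
      inv_mul_cancel_left₀ hpi.ne', ← intervalIntegral.integral_of_le hpi.le, ← hftc] at hj
    rw [← ofReal_integral_eq_lintegral_ofReal (hi2.const_mul _)
      (ae_of_all _ fun _ => by positivity), integral_const_mul]
    exact ENNReal.ofReal_le_ofReal hj
  -- Rotation invariance removes `θ`. For fixed `x`, `f' x y` is centred Gaussian in `y` with
  -- standard deviation at most `K`, and its moment generating function at `π / 2` gives `π ^ 2 * K
  -- ^ 2 / 8`.
  have hinner : ∀ θ : ℝ, ∫⁻ p, ENNReal.ofReal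
      ((π / 2)⁻¹ * exp (π / 2 * g (ContinuousLinearMap.rotation θ p))) ∂(μ.prod μ) ≤
      ENNReal.ofReal ((π / 2)⁻¹ * exp (π ^ 2 * K ^ 2 / 8)) := by
    intro θ
    have hm : Measurable fun p => ENNReal.ofReal ((π / 2)⁻¹ * exp (π / 2 * g p)) := by
      have : Continuous fun p => (π / 2)⁻¹ * exp (π / 2 * g p) := by fun_prop
      exact this.measurable.ennreal_ofReal
    rw [← lintegral_map hm (ContinuousLinearMap.rotation θ).continuous.measurable,
      stdGaussian_prod_map_rotation, lintegral_prod _ hm.aemeasurable]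
    refine (lintegral_mono (g := fun _ => ENNReal.ofReal ((π / 2)⁻¹ * exp (π ^ 2 * K ^ 2 / 8)))
      fun x => ?_).trans (by simp)
    simp only [g]
    simp_rw [ENNReal.ofReal_mul (inv_nonneg.2 hpi.le)]
    have e : ∀ y, π / 2 * f' x y = ((π / 2) • f' x) y := fun y => by simp
    simp_rw [e]
    rw [lintegral_const_mul _ (by fun_prop), lintegral_exp_strongDual_stdGaussian]
    refine mul_le_mul_right (ENNReal.ofReal_le_ofReal (exp_le_exp.2 ?_)) _
    rw [norm_smul, Real.norm_of_nonneg hpi.le]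
    have := pow_le_pow_left₀ (norm_nonneg _) (hK x) 2
    nlinarith [mul_le_mul_of_nonneg_left this (sq_nonneg π)]
  calc ∫⁻ p, ENNReal.ofReal (exp (f p.2 - f p.1)) ∂(μ.prod μ)
      ≤ ∫⁻ p, (∫⁻ θ in Set.Ioc (0 : ℝ) (π / 2), ENNReal.ofReal
        ((π / 2)⁻¹ * exp (π / 2 * g (ContinuousLinearMap.rotation θ p)))) ∂(μ.prod μ) :=
        lintegral_mono hjensen
    _ = ∫⁻ θ in Set.Ioc (0 : ℝ) (π / 2), ∫⁻ p, ENNReal.ofReal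
        ((π / 2)⁻¹ * exp (π / 2 * g (ContinuousLinearMap.rotation θ p))) ∂(μ.prod μ) := by
        refine lintegral_lintegral_swap (Measurable.aemeasurable ?_)
        have : Continuous fun q : (E × E) × ℝ =>
            (π / 2)⁻¹ * exp (π / 2 * g (ContinuousLinearMap.rotation q.2 q.1)) := by
          have h : Continuous fun q : (E × E) × ℝ => g (ContinuousLinearMap.rotation q.2 q.1) :=
            Continuous.comp (f := fun q : (E × E) × ℝ => (q.2, q.1)) hrot (by fun_prop)
          exact continuous_const.mul (continuous_exp.comp (continuous_const.mul h))
        exact this.measurable.ennreal_ofReal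
    _ ≤ ∫⁻ _ in Set.Ioc (0 : ℝ) (π / 2),
          ENNReal.ofReal ((π / 2)⁻¹ * exp (π ^ 2 * K ^ 2 / 8)) :=
        lintegral_mono fun θ => hinner θ
    _ = ENNReal.ofReal (exp (π ^ 2 * K ^ 2 / 8)) := by
        rw [setLIntegral_const, Real.volume_Ioc, sub_zero, ← ENNReal.ofReal_mul (by positivity)]
        congr 1
        field_simp

theorem integrable_of_hasFDerivAt_stdGaussian {f : E → ℝ} {f' : E → E →L[ℝ] ℝ}
    (hf : ∀ x, HasFDerivAt f (f' x) x) {K : ℝ} (hK : ∀ x, ‖f' x‖ ≤ K) :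
    Integrable f (stdGaussian E) := by
  have hfc : Continuous f := continuous_iff_continuousAt.2 fun z => (hf z).continuousAt
  refine Integrable.mono' (g := fun x => ‖f 0‖ + K * ‖x‖)
    ((integrable_const _).add ((IsGaussian.integrable_id (μ := stdGaussian E)).norm.const_mul K))
    hfc.aestronglyMeasurable (ae_of_all _ fun x => ?_)
  have h := convex_univ.norm_image_sub_le_of_norm_hasFDerivWithin_le
      (f := f) (f' := f') (C := K) (fun x _ => (hf x).hasFDerivWithinAt)
      (fun x _ => hK x) (x := 0) (y := x) (by simp) (by simp)
  rw [sub_zero] at h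
  have := norm_sub_norm_le (f x) (f 0)
  linarith

/-- Gaussian concentration for smooth Lipschitz functions. -/
theorem stdGaussian_le_integral_sub_le {f : E → ℝ} {f' : E → E →L[ℝ] ℝ}
    (hf : ∀ x, HasFDerivAt f (f' x) x) (hf' : Continuous f') {K : ℝ} (hK0 : 0 < K)
    (hK : ∀ x, ‖f' x‖ ≤ K) {t : ℝ} (ht : 0 ≤ t) :
    stdGaussian E {x | f x ≤ ∫ y, f y ∂(stdGaussian E) - t} ≤
      ENNReal.ofReal (exp (-(2 * t ^ 2 / (π ^ 2 * K ^ 2)))) := by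
  set μ := stdGaussian E
  have hfc : Continuous f := continuous_iff_continuousAt.2 fun z => (hf z).continuousAt
  have hint : Integrable f μ := integrable_of_hasFDerivAt_stdGaussian hf hK
  -- The minimizer of the Chernoff exponent `π ^ 2 * l ^ 2 * K ^ 2 / 8 - l * t`.
  set l := 4 * t / (π ^ 2 * K ^ 2) with hl
  have hl0 : 0 ≤ l := by positivity
  have hmp := lintegral_exp_sub_stdGaussian_le (f := fun x => l * f x) (f' := fun x => l • f' x)
    (fun x => (hf x).const_mul l) (hf'.const_smul l) (K := l * K) (fun x => by
      rw [norm_smul, Real.norm_of_nonneg hl0]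
      gcongr
      exact hK x)
  have hmeas : Measurable fun p : E × E => ENNReal.ofReal (exp (l * f p.2 - l * f p.1)) := by
    have : Continuous fun p : E × E => exp (l * f p.2 - l * f p.1) := by fun_prop
    exact this.measurable.ennreal_ofReal
  rw [lintegral_prod _ hmeas.aemeasurable] at hmp
  -- Jensen in the independent copy `y`, through the tangent line of `exp` at the mean; only `f`
  -- itself has to be integrable.
  have hlow : ∀ x, ENNReal.ofReal (exp (l * ∫ y, f y ∂μ - l * f x)) ≤
      ∫⁻ y, ENNReal.ofReal (exp (l * f y - l * f x)) ∂μ := by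
    intro x
    set m := ∫ y, f y ∂μ
    have hi : Integrable (fun y => exp (l * m - l * f x) * (1 + l * (f y - m))) μ :=
      ((integrable_const 1).add ((hint.sub (integrable_const m)).const_mul l)).const_mul _
    have hi2 : Integrable (fun y => l * (f y - m)) μ :=
      (hint.sub (integrable_const m)).const_mul l
    have hval : ∫ y, exp (l * m - l * f x) * (1 + l * (f y - m)) ∂μ = exp (l * m - l * f x) := by
      rw [integral_const_mul, integral_add (integrable_const _) hi2, integral_const_mul,
        integral_sub hint (integrable_const m)]
      simp [m]
    rw [← hval]
    refine (ofReal_integral_le_lintegral hi).trans ?_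
    refine lintegral_mono fun y => ENNReal.ofReal_le_ofReal ?_
    have e : l * f y - l * f x = (l * m - l * f x) + l * (f y - m) := by ring
    rw [e, exp_add]
    gcongr
    linarith [add_one_le_exp (l * (f y - m))]
  have hmark := mul_meas_ge_le_lintegral (μ := μ)
    (f := fun x => ENNReal.ofReal (exp (l * ∫ y, f y ∂μ - l * f x)))
    (by
      have : Continuous fun x => exp (l * ∫ y, f y ∂μ - l * f x) := by fun_prop
      exact this.measurable.ennreal_ofReal) (ENNReal.ofReal (exp (l * t)))
  have hsub : {x | f x ≤ ∫ y, f y ∂μ - t} ⊆ {x | ENNReal.ofReal (exp (l * t)) ≤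
      ENNReal.ofReal (exp (l * ∫ y, f y ∂μ - l * f x))} := by
    intro x hx
    simp only [Set.mem_ofPred_eq] at hx ⊢
    refine ENNReal.ofReal_le_ofReal (exp_le_exp.2 ?_)
    rw [← mul_sub]
    gcongr
    linarith
  have htot := (hmark.trans (lintegral_mono hlow)).trans hmp
  have h3 : μ {x | f x ≤ ∫ y, f y ∂μ - t} ≤
      ENNReal.ofReal (exp (π ^ 2 * (l * K) ^ 2 / 8)) / ENNReal.ofReal (exp (l * t)) := by
    rw [ENNReal.le_div_iff_mul_le (Or.inl (by simp [exp_pos])) (Or.inl ENNReal.ofReal_ne_top),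
      mul_comm]
    exact (mul_le_mul_right (measure_mono hsub) _).trans htot
  refine h3.trans ?_
  rw [← ENNReal.ofReal_div_of_pos (exp_pos _), ← exp_sub]
  refine ENNReal.ofReal_le_ofReal (exp_le_exp.2 (le_of_eq ?_))
  rw [hl]
  field_simp
  ring

/-- A dimension-free variance bound: `r ^ 2 ≤ 2 * (exp r + exp (-r))`, and Maurey–Pisier applies to
both `f` and `-f`. -/
theorem lintegral_sq_sub_stdGaussian_le {f : E → ℝ} {f' : E → E →L[ℝ] ℝ}
    (hf : ∀ x, HasFDerivAt f (f' x) x) (hf' : Continuous f') {K : ℝ} (hK : ∀ x, ‖f' x‖ ≤ K) :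
    ∫⁻ p, ENNReal.ofReal ((f p.2 - f p.1) ^ 2) ∂((stdGaussian E).prod (stdGaussian E)) ≤
      ENNReal.ofReal (4 * exp (π ^ 2 * K ^ 2 / 8)) := by
  have hfc : Continuous f := continuous_iff_continuousAt.2 fun z => (hf z).continuousAt
  have h1 := lintegral_exp_sub_stdGaussian_le hf hf' hK
  have h2 := lintegral_exp_sub_stdGaussian_le (f := fun x => -f x) (f' := fun x => -f' x)
    (fun x => (hf x).neg) hf'.neg (K := K) (fun x => by rw [norm_neg]; exact hK x)
  have hm : Measurable fun p : E × E => ENNReal.ofReal (exp (f p.2 - f p.1)) := by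
    have : Continuous fun p : E × E => exp (f p.2 - f p.1) := by fun_prop
    exact this.measurable.ennreal_ofReal
  have h4 : (4 : ℝ) * exp (π ^ 2 * K ^ 2 / 8) =
      2 * (exp (π ^ 2 * K ^ 2 / 8) + exp (π ^ 2 * K ^ 2 / 8)) := by ring
  rw [h4, ENNReal.ofReal_mul zero_le_two, ENNReal.ofReal_add (exp_pos _).le (exp_pos _).le]
  refine le_trans ?_ (mul_le_mul_right (add_le_add h1 h2) _)
  rw [← lintegral_add_left hm, ← lintegral_const_mul' _ _ ENNReal.ofReal_ne_top]
  refine lintegral_mono fun p => ?_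
  rw [← ENNReal.ofReal_add (exp_pos _).le (exp_pos _).le, ← ENNReal.ofReal_mul zero_le_two]
  refine ENNReal.ofReal_le_ofReal ?_
  have h3 : -f p.2 - -f p.1 = -(f p.2 - f p.1) := by ring
  rw [h3]
  set r := f p.2 - f p.1
  have h4 := quadratic_le_exp_of_nonneg (abs_nonneg r)
  have h5 : exp |r| + exp (-|r|) = exp r + exp (-r) := by
    rcases abs_cases r with ⟨h, -⟩ | ⟨h, -⟩ <;> rw [h]
    rw [neg_neg, add_comm]
  have h6 := exp_pos (-|r|)
  rw [sq_abs] at h4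
  linarith [abs_nonneg r]

end GaussianConcentration

/-! ### The smoothed min-max and Gordon's comparison inequality -/

section GordonComparison

open Real

/-- The linear map `ω ↦ (⟪a p, ω⟫)_p`. -/
noncomputable def innerFamily {E P : Type*} [NormedAddCommGroup E] [InnerProductSpace ℝ E]
    [Fintype P] (a : P → E) : E →L[ℝ] (P → ℝ) :=
  ContinuousLinearMap.pi fun p => innerSL ℝ (a p)

theorem innerFamily_apply {E P : Type*} [NormedAddCommGroup E] [InnerProductSpace ℝ E]
    [Fintype P] (a : P → E) (x : E) (p : P) : innerFamily a x p = inner ℝ (a p) x := rfl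

variable {I J : Type*} [Fintype I] [Fintype J]

/-- The row sums `∑ j, exp (z (i, j))`. -/
noncomputable def expRowSum (z : I × J → ℝ) (i : I) : ℝ := ∑ j, exp (z (i, j))

/-- A smooth approximation of `min_i max_j z (i, j)`. -/
noncomputable def softMinMax (z : I × J → ℝ) : ℝ := -log (∑ i, (expRowSum z i)⁻¹)

/-- The partial derivatives of `softMinMax`. -/
noncomputable def softWeight (p : I × J) (z : I × J → ℝ) : ℝ :=
  exp (z p - 2 * log (expRowSum z p.1) + softMinMax z)

/-- The derivative of `expRowSum`. -/
noncomputable def expRowSumDeriv (z : I × J → ℝ) (i : I) : (I × J → ℝ) →L[ℝ] ℝ :=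
  ∑ j, exp (z (i, j)) • ContinuousLinearMap.proj (i, j)

/-- The derivative of `softMinMax`. -/
noncomputable def softMinMaxDeriv (z : I × J → ℝ) : (I × J → ℝ) →L[ℝ] ℝ :=
  ∑ p, softWeight p z • ContinuousLinearMap.proj p

/-- The derivative of `softWeight`. -/
noncomputable def softWeightDeriv (p : I × J) (z : I × J → ℝ) : (I × J → ℝ) →L[ℝ] ℝ :=
  softWeight p z • (ContinuousLinearMap.proj p -
    (2 : ℝ) • ((expRowSum z p.1)⁻¹ • expRowSumDeriv z p.1) + softMinMaxDeriv z)

theorem softWeight_pos (p : I × J) (z : I × J → ℝ) : 0 < softWeight p z := exp_pos _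

theorem hasFDerivAt_expRowSum (z : I × J → ℝ) (i : I) :
    HasFDerivAt (fun z => expRowSum z i) (expRowSumDeriv z i) z := by
  refine HasFDerivAt.fun_sum fun j _ => ?_
  exact (hasFDerivAt_apply (i, j) z).exp

theorem continuous_expRowSum (i : I) : Continuous fun z : I × J → ℝ => expRowSum z i := by
  unfold expRowSum
  fun_prop

section

variable [Nonempty J]

theorem expRowSum_pos (z : I × J → ℝ) (i : I) : 0 < expRowSum z i :=
  Finset.sum_pos (fun _ _ => exp_pos _) Finset.univ_nonempty

variable [Nonempty I]

theorem sum_inv_expRowSum_pos (z : I × J → ℝ) : 0 < ∑ i, (expRowSum z i)⁻¹ :=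
  Finset.sum_pos (fun i _ => inv_pos.2 (expRowSum_pos z i)) Finset.univ_nonempty

/-- The exponential form in the definition makes positivity and differentiation immediate; this
product form serves to sum the weights and to recognize them as partial derivatives. -/
theorem softWeight_eq (p : I × J) (z : I × J → ℝ) :
    softWeight p z = (∑ i, (expRowSum z i)⁻¹)⁻¹ * ((expRowSum z p.1 ^ 2)⁻¹ * exp (z p)) := by
  have h1 := expRowSum_pos z p.1
  have h2 := sum_inv_expRowSum_pos z
  rw [softWeight, softMinMax, exp_add, exp_sub, exp_neg, exp_log h2, two_mul, exp_add, exp_log h1]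
  field_simp

theorem hasFDerivAt_softMinMax (z : I × J → ℝ) :
    HasFDerivAt softMinMax (softMinMaxDeriv z) z := by
  have h1 : ∀ i, HasFDerivAt (fun z : I × J → ℝ => (expRowSum z i)⁻¹)
      (-(expRowSum z i ^ 2)⁻¹ • expRowSumDeriv z i) z := fun i =>
    (hasDerivAt_inv (expRowSum_pos z i).ne').comp_hasFDerivAt z (hasFDerivAt_expRowSum z i)
  have h2 := ((HasFDerivAt.fun_sum (u := Finset.univ) fun i _ => h1 i).log
    (sum_inv_expRowSum_pos z).ne').neg
  refine h2.congr_fderiv ?_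
  ext v
  simp only [softMinMaxDeriv, expRowSumDeriv, softWeight_eq, Fintype.sum_prod_type, neg_apply,
    smul_apply, sum_apply, ContinuousLinearMap.proj_apply, smul_eq_mul, Finset.mul_sum,
    ← Finset.sum_neg_distrib]
  refine Finset.sum_congr rfl fun i _ => Finset.sum_congr rfl fun j _ => ?_
  ring

/-- The gradient is a probability vector because adding a constant to all entries adds it to the
min-max. This yields Lipschitz constant `1` for the sup norm. -/
theorem sum_softWeight (z : I × J → ℝ) : ∑ p, softWeight p z = 1 := by
  simp only [softWeight_eq, Fintype.sum_prod_type, ← Finset.mul_sum]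
  have : ∀ i, (expRowSum z i ^ 2)⁻¹ * ∑ j, exp (z (i, j)) = (expRowSum z i)⁻¹ := by
    intro i
    have := (expRowSum_pos z i).ne'
    change (expRowSum z i ^ 2)⁻¹ * expRowSum z i = _
    field_simp
  simp only [this]
  exact inv_mul_cancel₀ (sum_inv_expRowSum_pos z).ne'

theorem softWeight_le_one (p : I × J) (z : I × J → ℝ) : softWeight p z ≤ 1 := by
  rw [← sum_softWeight z]
  exact Finset.single_le_sum (f := fun p => softWeight p z) (fun q _ => (softWeight_pos q z).le)
    (Finset.mem_univ p)

theorem hasFDerivAt_softWeight (p : I × J) (z : I × J → ℝ) :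
    HasFDerivAt (softWeight p) (softWeightDeriv p z) z :=
  (((hasFDerivAt_apply p z).sub (((hasFDerivAt_expRowSum z p.1).log
    (expRowSum_pos z p.1).ne').const_mul 2)).add (hasFDerivAt_softMinMax z)).exp

theorem continuous_softWeight (p : I × J) : Continuous (softWeight p) :=
  continuous_iff_continuousAt.2 fun z => (hasFDerivAt_softWeight p z).continuousAt

theorem continuous_softMinMaxDeriv :
    Continuous (softMinMaxDeriv : (I × J → ℝ) → ((I × J → ℝ) →L[ℝ] ℝ)) := by
  unfold softMinMaxDeriv
  exact continuous_finsetSum _ fun p _ => (continuous_softWeight p).smul continuous_const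

theorem continuous_softWeightDeriv (p : I × J) : Continuous (softWeightDeriv p) := by
  have h1 : Continuous fun z : I × J → ℝ => expRowSumDeriv z p.1 :=
    continuous_finsetSum _ fun j _ =>
      Continuous.smul (f := fun z : I × J → ℝ => exp (z (p.1, j))) (by fun_prop) continuous_const
  have h2 : Continuous fun z : I × J → ℝ => (expRowSum z p.1)⁻¹ :=
    (continuous_expRowSum p.1).inv₀ fun z => (expRowSum_pos z p.1).ne'
  have h3 := continuous_softWeight p
  have h4 := continuous_softMinMaxDeriv (I := I) (J := J)
  unfold softWeightDeriv
  fun_prop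

theorem softMinMaxDeriv_apply (z v : I × J → ℝ) :
    softMinMaxDeriv z v = ∑ p, softWeight p z * v p := by
  simp [softMinMaxDeriv]

theorem softWeightDeriv_apply (p : I × J) (z v : I × J → ℝ) :
    softWeightDeriv p z v = softWeight p z * (v p -
      2 * ((expRowSum z p.1)⁻¹ * ∑ j, exp (z (p.1, j)) * v (p.1, j)) +
      ∑ q, softWeight q z * v q) := by
  simp [softWeightDeriv, softMinMaxDeriv, expRowSumDeriv]
  ring

theorem abs_softMinMaxDeriv_le (z v : I × J → ℝ) {c : ℝ} (hv : ∀ p, |v p| ≤ c) :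
    |softMinMaxDeriv z v| ≤ c := by
  rw [softMinMaxDeriv_apply]
  calc |∑ p, softWeight p z * v p| ≤ ∑ p, |softWeight p z * v p| :=
        Finset.abs_sum_le_sum_abs _ _
    _ ≤ ∑ p, softWeight p z * c := by
        refine Finset.sum_le_sum fun p _ => ?_
        rw [abs_mul, abs_of_pos (softWeight_pos p z)]
        exact mul_le_mul_of_nonneg_left (hv p) (softWeight_pos p z).le
    _ = c := by rw [← Finset.sum_mul, sum_softWeight, one_mul]

theorem norm_softMinMaxDeriv_le (z : I × J → ℝ) : ‖softMinMaxDeriv z‖ ≤ 1 :=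
  ContinuousLinearMap.opNorm_le_bound _ zero_le_one fun v => by
    rw [one_mul]
    exact abs_softMinMaxDeriv_le z v fun p => norm_le_pi_norm v p

theorem norm_softWeightDeriv_le (p : I × J) (z : I × J → ℝ) : ‖softWeightDeriv p z‖ ≤ 4 := by
  refine ContinuousLinearMap.opNorm_le_bound _ (by norm_num) fun v => ?_
  have h1 : |v p| ≤ ‖v‖ := norm_le_pi_norm v p
  have h2 := abs_softMinMaxDeriv_le z v fun p => norm_le_pi_norm v p
  have hS := expRowSum_pos z p.1
  have h3 : |(expRowSum z p.1)⁻¹ * ∑ j, exp (z (p.1, j)) * v (p.1, j)| ≤ ‖v‖ := by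
    rw [abs_mul, abs_of_pos (inv_pos.2 hS), inv_mul_le_iff₀ hS]
    calc |∑ j, exp (z (p.1, j)) * v (p.1, j)| ≤ ∑ j, |exp (z (p.1, j)) * v (p.1, j)| :=
          Finset.abs_sum_le_sum_abs _ _
      _ ≤ ∑ j, exp (z (p.1, j)) * ‖v‖ := by
          refine Finset.sum_le_sum fun j _ => ?_
          rw [abs_mul, abs_of_pos (exp_pos _)]
          exact mul_le_mul_of_nonneg_left (norm_le_pi_norm v _) (exp_pos _).le
      _ = expRowSum z p.1 * ‖v‖ := by rw [← Finset.sum_mul]; rfl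
  rw [softMinMaxDeriv_apply] at h2
  rw [softWeightDeriv_apply, Real.norm_eq_abs, abs_mul, abs_of_pos (softWeight_pos p z)]
  rw [abs_le] at h1 h2 h3
  calc _ ≤ 1 * (4 * ‖v‖) := by
        refine mul_le_mul (softWeight_le_one p z) (abs_le.2 ⟨?_, ?_⟩) (abs_nonneg _) zero_le_one
        · linarith
        · linarith
    _ = _ := one_mul _

/-- The gradient is invariant under constant shifts. This lets the two covariances in Gordon's
inequality differ by a global constant `c`, with no auxiliary Gaussian variable. -/
theorem softWeightDeriv_const (p : I × J) (z : I × J → ℝ) (c : ℝ) :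
    softWeightDeriv p z (fun _ => c) = 0 := by
  rw [softWeightDeriv_apply, ← Finset.sum_mul, ← Finset.sum_mul, sum_softWeight]
  have : (expRowSum z p.1)⁻¹ * ((∑ j, exp (z (p.1, j))) * c) = c :=
    inv_mul_cancel_left₀ (expRowSum_pos z p.1).ne' c
  rw [this]
  ring

/-- Mixed second derivatives across distinct rows are products of two weights, hence positive, and a
direction vanishing on the row of `p` sees only these. -/
theorem softWeightDeriv_nonneg (p : I × J) (z v : I × J → ℝ) (h0 : ∀ j, v (p.1, j) = 0)
    (hv : ∀ q, 0 ≤ v q) : 0 ≤ softWeightDeriv p z v := by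
  rw [softWeightDeriv_apply]
  have h1 : v p = 0 := h0 p.2
  rw [h1]
  simp only [h0, mul_zero, Finset.sum_const_zero, sub_zero, zero_add]
  exact mul_nonneg (softWeight_pos p z).le
    (Finset.sum_nonneg fun q _ => mul_nonneg (softWeight_pos q z).le (hv q))

/-- **Gordon's comparison inequality** for the smoothed min-max. -/
theorem integral_softMinMax_le {E : Type*} [NormedAddCommGroup E] [InnerProductSpace ℝ E]
    [FiniteDimensional ℝ E] [MeasurableSpace E] [BorelSpace E] {a b : I × J → E} (hab : ∀ p q, inner ℝ (a p) (b q) = (0 : ℝ))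
    {c : ℝ} (h1 : ∀ i j j', inner ℝ (a (i, j)) (a (i, j')) =
      (inner ℝ (b (i, j)) (b (i, j')) : ℝ) - c)
    (h2 : ∀ p q, inner ℝ (b p) (b q) - c ≤ (inner ℝ (a p) (a q) : ℝ)) :
    ∫ ω, softMinMax (innerFamily b ω) ∂(stdGaussian E) ≤
      ∫ ω, softMinMax (innerFamily a ω) ∂(stdGaussian E) := by
  set A := innerFamily b
  set B := innerFamily a
  have hK : ∀ z : I × J → ℝ, ‖softMinMaxDeriv z‖ ≤ 1 * (1 + ‖z‖) := fun z =>
    (norm_softMinMaxDeriv_le z).trans (by linarith [norm_nonneg z])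
  have hd := fun θ => hasDerivAt_integral_comp_rotation
    (IsGaussian.memLp_two_id (μ := stdGaussian E)) hasFDerivAt_softMinMax
    continuous_softMinMaxDeriv hK A B θ
  have hpos : ∀ θ ∈ Set.Icc (0 : ℝ) (π / 2), 0 ≤ ∫ ω, softMinMaxDeriv (cos θ • A ω + sin θ • B ω)
      (-sin θ • A ω + cos θ • B ω) ∂(stdGaussian E) := by
    intro θ hθ
    set Z : E →L[ℝ] (I × J → ℝ) := cos θ • A + sin θ • B with hZ
    -- Integration by parts replaces the velocity of the interpolated process by its covariance with
    -- the process itself.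
    have hterm : ∀ p, ∫ ω, inner ℝ (-sin θ • b p + cos θ • a p) ω * softWeight p (Z ω)
        ∂(stdGaussian E) = ∫ ω, softWeightDeriv p (Z ω) (Z (-sin θ • b p + cos θ • a p))
        ∂(stdGaussian E) := by
      intro p
      refine integral_inner_mul_stdGaussian (h := fun ω => softWeight p (Z ω))
        (h' := fun ω => (softWeightDeriv p (Z ω)).comp Z) (K := max 1 (4 * ‖Z‖))
        (fun x => (hasFDerivAt_softWeight p (Z x)).comp x Z.hasFDerivAt) ?_ (fun x => ?_)
        (fun x => ?_) _
      · have := (continuous_softWeightDeriv p).comp Z.continuous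
        exact this.clm_comp continuous_const
      · rw [abs_of_pos (softWeight_pos p _)]
        exact (softWeight_le_one p _).trans (le_max_left _ _)
      · refine ((ContinuousLinearMap.opNorm_comp_le _ _).trans ?_).trans (le_max_right _ _)
        have := norm_softWeightDeriv_le p (Z x)
        gcongr
    have hsum : ∀ ω, softMinMaxDeriv (cos θ • A ω + sin θ • B ω) (-sin θ • A ω + cos θ • B ω) =
        ∑ p, inner ℝ (-sin θ • b p + cos θ • a p) ω * softWeight p (Z ω) := by
      intro ω
      rw [softMinMaxDeriv_apply]
      refine Finset.sum_congr rfl fun p _ => ?_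
      simp only [Pi.add_apply, Pi.smul_apply, smul_eq_mul, A, B, innerFamily_apply, hZ,
        add_apply, smul_apply, inner_add_left, real_inner_smul_left]
      ring
    simp_rw [hsum]
    rw [integral_finsetSum]
    · refine Finset.sum_nonneg fun p _ => ?_
      rw [hterm]
      refine integral_nonneg fun ω => ?_
      have hsc : 0 ≤ sin θ * cos θ := mul_nonneg
        (sin_nonneg_of_nonneg_of_le_pi hθ.1 (by linarith [hθ.2, pi_pos]))
        (cos_nonneg_of_neg_pi_div_two_le_of_le (by linarith [hθ.1, pi_pos]) hθ.2)
      -- Orthogonality of the two families kills the cross terms. Up to a constant, which the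
      -- derivative ignores, what remains is the covariance gap: zero on the row of `p` by `h1` and
      -- nonnegative everywhere by `h2`.
      have hv : Z (-sin θ • b p + cos θ • a p) = (fun q => sin θ * cos θ *
          (inner ℝ (a q) (a p) - inner ℝ (b q) (b p) + c)) + fun _ => -(sin θ * cos θ * c) := by
        ext q
        have e1 := hab q p
        have e2 : inner ℝ (b q) (a p) = (0 : ℝ) := by rw [real_inner_comm]; exact hab p q
        simp only [hZ, A, B, add_apply, smul_apply, Pi.add_apply, Pi.smul_apply, smul_eq_mul,
          innerFamily_apply, inner_add_right, real_inner_smul_right, e1, e2]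
        ring
      simp only [Pi.zero_apply]
      rw [hv, map_add, softWeightDeriv_const, add_zero]
      refine softWeightDeriv_nonneg p _ _ (fun j => ?_) fun q => mul_nonneg hsc ?_
      · have := h1 p.1 j p.2
        rw [Prod.mk.eta] at this
        rw [this]
        ring
      · linarith [h2 q p]
    · intro p _
      refine Integrable.mul_bdd (c := 1) ?_ ?_ (ae_of_all _ fun ω => ?_)
      · exact IsGaussian.integrable_dual (stdGaussian E) (innerSL ℝ (-sin θ • b p + cos θ • a p))
      · exact ((continuous_softWeight p).comp Z.continuous).aestronglyMeasurable
      · rw [Real.norm_of_nonneg (softWeight_pos p _).le]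
        exact softWeight_le_one p _
  have hmono : MonotoneOn (fun θ => ∫ ω, softMinMax (cos θ • A ω + sin θ • B ω) ∂(stdGaussian E))
      (Set.Icc 0 (π / 2)) := by
    refine monotoneOn_of_deriv_nonneg (convex_Icc _ _)
      (fun θ _ => (hd θ).2.2.continuousAt.continuousWithinAt)
      (fun θ _ => (hd θ).2.2.differentiableAt.differentiableWithinAt) fun θ hθ => ?_
    rw [(hd θ).2.2.deriv]
    exact hpos θ (interior_subset hθ)
  have hpi : (0 : ℝ) ≤ π / 2 := by positivity
  have := hmono (Set.left_mem_Icc.2 hpi) (Set.right_mem_Icc.2 hpi) hpi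
  simpa using this

end

end GordonComparison

/-! ### From the comparison of means to a lower tail -/

section GordonTail

open Real

variable {I J : Type*} [Fintype I] [Fintype J] [Nonempty I] [Nonempty J]

/-- The row-wise log-sum-exp overshoots the maximum by at most `log |J|`, and the smooth minimum
only undershoots. The companion bound from below loses only `log |I|`. -/
theorem softMinMax_le {z : I × J → ℝ} {r : ℝ} {i : I} (h : ∀ j, z (i, j) ≤ r) :
    softMinMax z ≤ r + log (Fintype.card J) := by
  have hJ : (0 : ℝ) < Fintype.card J := by exact_mod_cast Fintype.card_pos
  have h1 : expRowSum z i ≤ Fintype.card J * exp r := by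
    calc expRowSum z i ≤ ∑ _j : J, exp r := Finset.sum_le_sum fun j _ => exp_le_exp.2 (h j)
      _ = _ := by simp
  have h2 : (Fintype.card J * exp r)⁻¹ ≤ ∑ i, (expRowSum z i)⁻¹ :=
    (inv_anti₀ (expRowSum_pos z i) h1).trans
      (Finset.single_le_sum (f := fun i => (expRowSum z i)⁻¹)
        (fun i _ => (inv_pos.2 (expRowSum_pos z i)).le) (Finset.mem_univ i))
  have h3 := log_le_log (by positivity) h2
  rw [log_inv, log_mul hJ.ne' (exp_pos r).ne', log_exp] at h3
  rw [softMinMax]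
  linarith

theorem le_softMinMax {z : I × J → ℝ} {r : ℝ} (h : ∀ i, ∃ j, r ≤ z (i, j)) :
    r - log (Fintype.card I) ≤ softMinMax z := by
  have hI : (0 : ℝ) < Fintype.card I := by exact_mod_cast Fintype.card_pos
  have h1 : ∀ i, (expRowSum z i)⁻¹ ≤ (exp r)⁻¹ := by
    intro i
    obtain ⟨j, hj⟩ := h i
    refine inv_anti₀ (exp_pos r) ((exp_le_exp.2 hj).trans ?_)
    exact Finset.single_le_sum (f := fun j => exp (z (i, j))) (fun j _ => (exp_pos _).le)
      (Finset.mem_univ j)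
  have h2 : ∑ i, (expRowSum z i)⁻¹ ≤ Fintype.card I * (exp r)⁻¹ := by
    calc _ ≤ ∑ _i : I, (exp r)⁻¹ := Finset.sum_le_sum fun i _ => h1 i
      _ = _ := by simp
  have h3 := log_le_log (sum_inv_expRowSum_pos z) h2
  rw [log_mul hI.ne' (by positivity), log_inv, log_exp] at h3
  rw [softMinMax]
  linarith

variable {E : Type*} [NormedAddCommGroup E] [InnerProductSpace ℝ E]

/-- The smoothed minimum over `i` of the maximum over `j` of `⟪a (i, j), x⟫`, at inverse
temperature `β`. -/
noncomputable def softValue (β : ℝ) (a : I × J → E) (x : E) : ℝ :=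
  β⁻¹ * softMinMax (innerFamily (fun p => β • a p) x)

/-- The derivative of `softValue`. -/
noncomputable def softValueDeriv (β : ℝ) (a : I × J → E) (x : E) : E →L[ℝ] ℝ :=
  β⁻¹ • (softMinMaxDeriv (innerFamily (fun p => β • a p) x)).comp (innerFamily (fun p => β • a p))

theorem hasFDerivAt_softValue (β : ℝ) (a : I × J → E) (x : E) :
    HasFDerivAt (softValue β a) (softValueDeriv β a x) x :=
  ((hasFDerivAt_softMinMax (innerFamily (fun p => β • a p) x)).comp x
    (innerFamily (fun p => β • a p)).hasFDerivAt).const_mul β⁻¹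

theorem continuous_softValueDeriv (β : ℝ) (a : I × J → E) : Continuous (softValueDeriv β a) := by
  have h := (continuous_softMinMaxDeriv (I := I) (J := J)).comp
    (innerFamily (fun p => β • a p)).continuous
  have h2 : Continuous fun x : E => (softMinMaxDeriv (innerFamily (fun p => β • a p) x)).comp
      (innerFamily (fun p => β • a p)) := h.clm_comp continuous_const
  exact h2.const_smul β⁻¹

/-- The gradient is a convex combination of the vectors `a p`, as the factors `β` cancel. The
Lipschitz constant therefore depends on neither the temperature nor the size of the nets. -/
theorem norm_softValueDeriv_le {β : ℝ} (hβ : 0 < β) {a : I × J → E} (ha : ∀ p, ‖a p‖ ≤ 1) (x : E) :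
    ‖softValueDeriv β a x‖ ≤ 1 := by
  refine ContinuousLinearMap.opNorm_le_bound _ zero_le_one fun v => ?_
  rw [one_mul]
  change |β⁻¹ * softMinMaxDeriv _ (innerFamily (fun p => β • a p) v)| ≤ _
  rw [abs_mul, abs_of_pos (inv_pos.2 hβ), inv_mul_le_iff₀ hβ]
  refine abs_softMinMaxDeriv_le _ _ fun p => ?_
  rw [innerFamily_apply, real_inner_smul_left, abs_mul, abs_of_pos hβ]
  have h1 := (abs_real_inner_le_norm (a p) v)
  have h2 := mul_le_mul_of_nonneg_right (ha p) (norm_nonneg v)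
  exact mul_le_mul_of_nonneg_left (by linarith) hβ.le

theorem softValue_le {β : ℝ} (hβ : 0 < β) {a : I × J → E} {x : E} {r : ℝ} {i : I}
    (h : ∀ j, inner ℝ (a (i, j)) x ≤ r) : softValue β a x ≤ r + β⁻¹ * log (Fintype.card J) := by
  have h1 := softMinMax_le (z := innerFamily (fun p => β • a p) x) (r := β * r) (i := i)
    fun j => by
      rw [innerFamily_apply, real_inner_smul_left]
      exact mul_le_mul_of_nonneg_left (h j) hβ.le
  have h2 := mul_le_mul_of_nonneg_left h1 (inv_pos.2 hβ).le
  rwa [mul_add, inv_mul_cancel_left₀ hβ.ne'] at h2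

theorem le_softValue {β : ℝ} (hβ : 0 < β) {a : I × J → E} {x : E} {r : ℝ}
    (h : ∀ i, ∃ j, r ≤ inner ℝ (a (i, j)) x) :
    r - β⁻¹ * log (Fintype.card I) ≤ softValue β a x := by
  have h1 := le_softMinMax (z := innerFamily (fun p => β • a p) x) (r := β * r) fun i => by
    obtain ⟨j, hj⟩ := h i
    refine ⟨j, ?_⟩
    rw [innerFamily_apply, real_inner_smul_left]
    exact mul_le_mul_of_nonneg_left hj hβ.le
  have h2 := mul_le_mul_of_nonneg_left h1 (inv_pos.2 hβ).le
  rwa [mul_sub, inv_mul_cancel_left₀ hβ.ne'] at h2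

variable [FiniteDimensional ℝ E] [MeasurableSpace E] [BorelSpace E]

/-- Concentration does not depend on `β`, so it may be taken large enough for the whole smoothing
error to be at most `1`. The summand `1` in the witness keeps it positive when both logarithms
vanish. -/
theorem exists_inverseTemperature (I J : Type*) [Fintype I] [Fintype J] :
    ∃ β : ℝ, 0 < β ∧ β⁻¹ * log (Fintype.card I) + β⁻¹ * log (Fintype.card J) ≤ 1 := by
  have hI : 0 ≤ log (Fintype.card I) := log_natCast_nonneg _
  have hJ : 0 ≤ log (Fintype.card J) := log_natCast_nonneg _
  refine ⟨log (Fintype.card I) + log (Fintype.card J) + 1, by positivity, ?_⟩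
  rw [← mul_add, inv_mul_le_iff₀ (by positivity)]
  linarith

/-- Gordon's comparison combined with Gaussian concentration: a lower tail bound for the min-max
of the process `a` in terms of the mean of a lower bound for the min-max of the process `b`. -/
theorem stdGaussian_minMax_le {a b : I × J → E} (hab : ∀ p q, inner ℝ (a p) (b q) = (0 : ℝ))
    (ha : ∀ p, ‖a p‖ ≤ 1) {c : ℝ} (h1 : ∀ i j j', inner ℝ (a (i, j)) (a (i, j')) =
      (inner ℝ (b (i, j)) (b (i, j')) : ℝ) - c)
    (h2 : ∀ p q, inner ℝ (b p) (b q) - c ≤ (inner ℝ (a p) (a q) : ℝ))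
    {m : E → ℝ} (hm : Integrable m (stdGaussian E))
    (hmb : ∀ x i, ∃ j, m x ≤ inner ℝ (b (i, j)) x) {t : ℝ} (ht : 0 ≤ t) :
    stdGaussian E {x | ∃ i, ∀ j, inner ℝ (a (i, j)) x ≤ ∫ y, m y ∂(stdGaussian E) - t - 1} ≤
      ENNReal.ofReal (exp (-(2 * t ^ 2 / π ^ 2))) := by
  obtain ⟨β, hβ, hlog⟩ := exists_inverseTemperature I J
  have hconc := stdGaussian_le_integral_sub_le (hasFDerivAt_softValue β a)
    (continuous_softValueDeriv β a) one_pos (norm_softValueDeriv_le hβ ha) ht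
  rw [one_pow, mul_one] at hconc
  refine (measure_mono ?_).trans hconc
  have hintb : Integrable (softValue β b) (stdGaussian E) := by
    have hb' : ∀ x, ‖softValueDeriv β b x‖ ≤ ‖β⁻¹‖ * (1 * ‖innerFamily (fun p => β • b p)‖) := by
      intro x
      rw [softValueDeriv, norm_smul]
      refine mul_le_mul_of_nonneg_left ((ContinuousLinearMap.opNorm_comp_le _ _).trans ?_)
        (norm_nonneg _)
      exact mul_le_mul_of_nonneg_right (norm_softMinMaxDeriv_le _) (norm_nonneg _)
    exact integrable_of_hasFDerivAt_stdGaussian (hasFDerivAt_softValue β b) hb'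
  have hgordon : ∫ x, softValue β b x ∂(stdGaussian E) ≤
      ∫ x, softValue β a x ∂(stdGaussian E) := by
    simp only [softValue]
    rw [integral_const_mul, integral_const_mul]
    refine mul_le_mul_of_nonneg_left ?_ (inv_pos.2 hβ).le
    -- Both families are scaled by `β`, so covariances and their gap scale by its square.
    refine integral_softMinMax_le (c := β * (β * c)) (fun p q => ?_) (fun i j j' => ?_)
      (fun p q => ?_)
    · rw [real_inner_smul_left, real_inner_smul_right, hab, mul_zero, mul_zero]
    · simp only [real_inner_smul_left, real_inner_smul_right, h1]
      ring
    · simp only [real_inner_smul_left, real_inner_smul_right]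
      rw [← mul_sub, ← mul_sub]
      exact mul_le_mul_of_nonneg_left (mul_le_mul_of_nonneg_left (h2 p q) hβ.le) hβ.le
  have hlow : ∫ x, m x ∂(stdGaussian E) - β⁻¹ * log (Fintype.card I) ≤
      ∫ x, softValue β b x ∂(stdGaussian E) := by
    have : ∫ x, (m x - β⁻¹ * log (Fintype.card I)) ∂(stdGaussian E) =
        ∫ x, m x ∂(stdGaussian E) - β⁻¹ * log (Fintype.card I) := by
      rw [integral_sub hm (integrable_const _)]
      simp
    rw [← this]
    exact integral_mono (hm.sub (integrable_const _)) hintb fun x => le_softValue hβ (hmb x)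
  rintro x ⟨i, hi⟩
  have := softValue_le hβ hi
  simp only [Set.mem_ofPred_eq]
  linarith

/-- The one-row case of `softValue`: nothing is lost from below, at most `1` from above, and the
variance bound does not see the number of vectors. -/
theorem exists_smooth_max {a : J → E} (ha : ∀ j, ‖a j‖ ≤ 1) :
    ∃ f : E → ℝ, Continuous f ∧ (∀ x r, (∀ j, inner ℝ (a j) x ≤ r) → f x ≤ r + 1) ∧
      (∀ x j, inner ℝ (a j) x ≤ f x) ∧
      ∫⁻ p, ENNReal.ofReal ((f p.2 - f p.1) ^ 2) ∂((stdGaussian E).prod (stdGaussian E)) ≤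
        ENNReal.ofReal (4 * exp (π ^ 2 / 8)) := by
  obtain ⟨β, hβ, hlog⟩ := exists_inverseTemperature Unit J
  have hJ : 0 ≤ log (Fintype.card J) := log_natCast_nonneg _
  simp only [Fintype.card_unit, Nat.cast_one, log_one, mul_zero, zero_add] at hlog
  refine ⟨softValue β fun p : Unit × J => a p.2, ?_, fun x r h => ?_, fun x j => ?_, ?_⟩
  · exact continuous_iff_continuousAt.2 fun x => (hasFDerivAt_softValue β _ x).continuousAt
  · have := softValue_le hβ (a := fun p : Unit × J => a p.2) (i := ()) h
    linarith
  · have := le_softValue hβ (a := fun p : Unit × J => a p.2) (x := x) (r := inner ℝ (a j) x)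
      fun _ => ⟨j, le_rfl⟩
    simpa using this
  · have := lintegral_sq_sub_stdGaussian_le (hasFDerivAt_softValue β fun p : Unit × J => a p.2)
      (continuous_softValueDeriv β _) (norm_softValueDeriv_le hβ fun p => ha p.2)
    simpa using this

end GordonTail

/-! ### Projections onto closed convex cones -/

section Cones

variable {d : ℕ}

theorem coneProj_mem (C : ClosedConvexCone d) (y : Euc d) : coneProj C y ∈ C :=
  (C.exists_nearest y).choose_spec.1

theorem inner_sub_coneProj_sub_le (C : ClosedConvexCone d) (y : Euc d) {z : Euc d} (hz : z ∈ C) :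
    inner ℝ (y - coneProj C y) (z - coneProj C y) ≤ 0 := by
  have hmin := (C.exists_nearest y).choose_spec.2
  refine (norm_eq_iInf_iff_real_inner_le_zero C.convex (coneProj_mem C y)).1 ?_ z hz
  have : Nonempty (C : Set (Euc d)) := ⟨⟨_, coneProj_mem C y⟩⟩
  refine le_antisymm (le_ciInf fun w => hmin w w.2) ?_
  exact ciInf_le (f := fun w : (C : Set (Euc d)) => ‖y - w‖)
    ⟨0, by rintro _ ⟨w, rfl⟩; exact norm_nonneg _⟩ ⟨_, coneProj_mem C y⟩

/-- The variational inequality is tested at `0` and at twice the projection, both in the cone. -/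
theorem inner_sub_coneProj_self (C : ClosedConvexCone d) (y : Euc d) :
    inner ℝ (y - coneProj C y) (coneProj C y) = 0 := by
  set p := coneProj C y
  have h1 := inner_sub_coneProj_sub_le C y (z := 0) C.zero_mem
  have h2 := inner_sub_coneProj_sub_le C y (z := p + p)
    (C.add_mem (coneProj_mem C y) (coneProj_mem C y))
  rw [add_sub_cancel_right] at h2
  rw [zero_sub, inner_neg_right] at h1
  linarith

theorem inner_sub_coneProj_le (C : ClosedConvexCone d) (y : Euc d) {z : Euc d} (hz : z ∈ C) :
    inner ℝ (y - coneProj C y) z ≤ 0 := by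
  have h1 := inner_sub_coneProj_sub_le C y hz
  rw [inner_sub_right, inner_sub_coneProj_self] at h1
  linarith

theorem inner_coneProj_self (C : ClosedConvexCone d) (y : Euc d) :
    inner ℝ y (coneProj C y) = ‖coneProj C y‖ ^ 2 := by
  have := inner_sub_coneProj_self C y
  rw [inner_sub_left, real_inner_self_eq_norm_sq] at this
  linarith

/-- Together with `exists_unit_of_coneProj_ne_zero`, this identifies `‖Π_C y‖` as the support
function of the unit ball of `C`, attained at a unit vector when nonzero. It is what makes the
restricted singular value a min-max. -/
theorem inner_le_norm_coneProj (C : ClosedConvexCone d) (y : Euc d) {z : Euc d} (hz : z ∈ C)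
    (hz1 : ‖z‖ ≤ 1) : inner ℝ y z ≤ ‖coneProj C y‖ := by
  have h1 := inner_sub_coneProj_le C y hz
  rw [inner_sub_left] at h1
  have h2 := real_inner_le_norm (coneProj C y) z
  nlinarith [norm_nonneg (coneProj C y)]

theorem exists_unit_of_coneProj_ne_zero (C : ClosedConvexCone d) {y : Euc d}
    (hy : coneProj C y ≠ 0) : ∃ z ∈ C, ‖z‖ = 1 ∧ inner ℝ y z = ‖coneProj C y‖ := by
  have hn : ‖coneProj C y‖ ≠ 0 := norm_ne_zero_iff.2 hy
  refine ⟨‖coneProj C y‖⁻¹ • coneProj C y,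
    C.smul_mem (coneProj_mem C y) (inv_nonneg.2 (norm_nonneg _)), ?_, ?_⟩
  · rw [norm_smul, norm_inv, norm_norm, inv_mul_cancel₀ hn]
  · rw [real_inner_smul_right, inner_coneProj_self]
    field_simp

/-- A maximum of linear functionals of norm at most `1` is 1-Lipschitz. -/
theorem norm_coneProj_le_add (C : ClosedConvexCone d) (y y' : Euc d) :
    ‖coneProj C y‖ ≤ ‖coneProj C y'‖ + ‖y - y'‖ := by
  by_cases hy : coneProj C y = 0
  · rw [hy, norm_zero]
    positivity
  obtain ⟨z, hz, hz1, h⟩ := exists_unit_of_coneProj_ne_zero C hy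
  have h1 := inner_le_norm_coneProj C y' hz hz1.le
  have h2 := real_inner_le_norm (y - y') z
  rw [inner_sub_left, hz1] at h2
  linarith

theorem norm_coneProj_le (C : ClosedConvexCone d) (y : Euc d) : ‖coneProj C y‖ ≤ ‖y‖ := by
  by_cases hy : coneProj C y = 0
  · rw [hy, norm_zero]
    positivity
  obtain ⟨z, -, hz1, h⟩ := exists_unit_of_coneProj_ne_zero C hy
  have h2 := real_inner_le_norm y z
  rw [hz1] at h2
  linarith

theorem continuous_norm_coneProj (C : ClosedConvexCone d) :
    Continuous fun y => ‖coneProj C y‖ := by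
  refine LipschitzWith.continuous (K := 1) (LipschitzWith.of_le_add fun x y => ?_)
  rw [dist_eq_norm]
  exact norm_coneProj_le_add C x y

theorem exists_unit_mem {C : ClosedConvexCone d} (hC : C ≠ ⊥) : ∃ x ∈ C, ‖x‖ = 1 := by
  have : ∃ x ∈ C, x ≠ 0 := by
    by_contra! h
    refine hC (le_antisymm (fun x hx => ?_) bot_le)
    rw [h x hx]
    exact zero_mem _
  obtain ⟨x, hx, h0⟩ := this
  have hn : ‖x‖ ≠ 0 := norm_ne_zero_iff.2 h0
  refine ⟨‖x‖⁻¹ • x, C.smul_mem hx (inv_nonneg.2 (norm_nonneg _)), ?_⟩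
  rw [norm_smul, norm_inv, norm_norm, inv_mul_cancel₀ hn]

theorem pos_of_cone_ne_bot {C : ClosedConvexCone d} (hC : C ≠ ⊥) : 0 < d := by
  rcases Nat.eq_zero_or_pos d with rfl | h
  · obtain ⟨x, -, hx⟩ := exists_unit_mem hC
    rw [Subsingleton.elim x 0, norm_zero] at hx
    norm_num at hx
  · exact h

/-- Finite nets of the unit vectors in a closed convex cone. -/
theorem exists_finite_net (C : ClosedConvexCone d) (hC : C ≠ ⊥) {ε : ℝ} (hε : 0 < ε) :
    ∃ t : Finset (Euc d), t.Nonempty ∧ (∀ x ∈ t, x ∈ C ∧ ‖x‖ = 1) ∧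
      ∀ x ∈ C, ‖x‖ = 1 → ∃ y ∈ t, ‖x - y‖ ≤ ε := by
  have hcomp : IsCompact ((C : Set (Euc d)) ∩ Metric.sphere 0 1) :=
    (isCompact_sphere (0 : Euc d) 1).inter_left C.isClosed
  obtain ⟨t, hts, hfin, hcov⟩ := hcomp.finite_cover_balls hε
  have hcov' : ∀ x ∈ C, ‖x‖ = 1 → ∃ y ∈ t, ‖x - y‖ ≤ ε := by
    intro x hx hx1
    have := hcov ⟨hx, by simpa using hx1⟩
    simp only [Set.mem_iUnion, Metric.mem_ball, dist_eq_norm, exists_prop] at this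
    obtain ⟨y, hy, h⟩ := this
    exact ⟨y, hy, h.le⟩
  refine ⟨hfin.toFinset, ?_, fun x hx => ?_, fun x hx hx1 => ?_⟩
  · obtain ⟨x, hx, hx1⟩ := exists_unit_mem hC
    obtain ⟨y, hy, -⟩ := hcov' x hx hx1
    exact ⟨y, hfin.mem_toFinset.2 hy⟩
  · have := hts (hfin.mem_toFinset.1 hx)
    exact ⟨this.1, by simpa using this.2⟩
  · obtain ⟨y, hy, h⟩ := hcov' x hx hx1
    exact ⟨y, hfin.mem_toFinset.2 hy, h⟩

end Cones

/-! ### Continuity and measurability of the condition number -/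

section RestrictedSingularValue

variable {n m : ℕ}

/-- A matrix as a continuous linear map between Euclidean spaces. -/
noncomputable def matCLM (A : Matrix (Fin n) (Fin m) ℝ) : Euc m →L[ℝ] Euc n :=
  LinearMap.toContinuousLinearMap (Matrix.toEuclideanLin A)

theorem matCLM_apply (A : Matrix (Fin n) (Fin m) ℝ) (x : Euc m) :
    matCLM A x = Matrix.toEuclideanLin A x := rfl

theorem matOpNorm_eq (A : Matrix (Fin n) (Fin m) ℝ) : matOpNorm A = ‖matCLM A‖ := rfl

theorem continuous_matCLM :
    Continuous (matCLM : Matrix (Fin n) (Fin m) ℝ → (Euc m →L[ℝ] Euc n)) := by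
  let f : Matrix (Fin n) (Fin m) ℝ →ₗ[ℝ] (Euc m →L[ℝ] Euc n) :=
    (LinearMap.toContinuousLinearMap : (Euc m →ₗ[ℝ] Euc n) ≃ₗ[ℝ] _).toLinearMap.comp
      (Matrix.toEuclideanLin : Matrix (Fin n) (Fin m) ℝ ≃ₗ[ℝ] _).toLinearMap
  exact f.continuous_of_finiteDimensional

theorem continuous_matOpNorm : Continuous (matOpNorm : Matrix (Fin n) (Fin m) ℝ → ℝ) :=
  continuous_matCLM.norm

theorem sres_le (A : Matrix (Fin n) (Fin m) ℝ) {C : ClosedConvexCone m}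
    (D : ClosedConvexCone n) {x : Euc m} (hx : x ∈ C) (hx1 : ‖x‖ = 1) :
    sres A C D ≤ ‖coneProj D (matCLM A x)‖ :=
  ciInf_le (f := fun x : {x : Euc m // x ∈ C ∧ ‖x‖ = 1} =>
    ‖coneProj D (Matrix.toEuclideanLin A x)‖)
    ⟨0, by rintro _ ⟨w, rfl⟩; exact norm_nonneg _⟩ ⟨x, hx, hx1⟩

theorem le_sres (A : Matrix (Fin n) (Fin m) ℝ) {C : ClosedConvexCone m} (hC : C ≠ ⊥)
    (D : ClosedConvexCone n) {r : ℝ}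
    (h : ∀ x ∈ C, ‖x‖ = 1 → r ≤ ‖coneProj D (matCLM A x)‖) : r ≤ sres A C D := by
  obtain ⟨x, hx, hx1⟩ := exists_unit_mem hC
  have : Nonempty {x : Euc m // x ∈ C ∧ ‖x‖ = 1} := ⟨⟨x, hx, hx1⟩⟩
  exact le_ciInf fun x => h x x.2.1 x.2.2

/-- An infimum, over unit vectors, of functions that are 1-Lipschitz in the operator norm. -/
theorem continuous_sres {C : ClosedConvexCone m} (hC : C ≠ ⊥) (D : ClosedConvexCone n) :
    Continuous fun A : Matrix (Fin n) (Fin m) ℝ => sres A C D := by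
  have hlip : ∀ A B : Matrix (Fin n) (Fin m) ℝ,
      sres A C D ≤ sres B C D + ‖matCLM A - matCLM B‖ := by
    intro A B
    rw [← sub_le_iff_le_add]
    refine le_sres B hC D fun x hx hx1 => ?_
    have h1 := sres_le A D hx hx1
    have h2 := norm_coneProj_le_add D (matCLM A x) (matCLM B x)
    have h3 := (matCLM A - matCLM B).le_opNorm x
    rw [hx1, mul_one, sub_apply] at h3
    linarith
  refine continuous_iff_continuousAt.2 fun A => ?_
  rw [ContinuousAt, tendsto_iff_norm_sub_tendsto_zero]
  have h0 : Tendsto (fun B : Matrix (Fin n) (Fin m) ℝ => ‖matCLM B - matCLM A‖) (𝓝 A) (𝓝 0) := by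
    have : Continuous fun B : Matrix (Fin n) (Fin m) ℝ => ‖matCLM B - matCLM A‖ :=
      (continuous_matCLM.sub continuous_const).norm
    simpa using this.tendsto A
  refine squeeze_zero (fun _ => norm_nonneg _) (fun B => ?_) h0
  rw [Real.norm_eq_abs, abs_le]
  have h1 := hlip A B
  have h2 := hlip B A
  rw [norm_sub_rev] at h1
  constructor <;> linarith

instance matrixBorelSpace : BorelSpace (Matrix (Fin n) (Fin m) ℝ) :=
  inferInstanceAs (BorelSpace (Fin n → Fin m → ℝ))

theorem measurable_extRatio : Measurable fun p : ℝ × ℝ => extRatio p.1 p.2 := by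
  unfold extRatio
  exact Measurable.ite (measurable_snd (measurableSet_singleton 0)) measurable_const
    (measurable_fst.div measurable_snd).ennreal_ofReal

theorem measurable_renegarCond {C : ClosedConvexCone m} {D : ClosedConvexCone n} (hC : C ≠ ⊥)
    (hD : D ≠ ⊥) : Measurable (renegarCond C D) := by
  have h1 : Measurable fun A : Matrix (Fin n) (Fin m) ℝ => (matOpNorm A, sres A C D) :=
    (continuous_matOpNorm.prodMk (continuous_sres hC D)).measurable
  have h2 : Measurable fun A : Matrix (Fin n) (Fin m) ℝ =>
      (matOpNorm A, sres (-A.transpose) D C) :=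
    (continuous_matOpNorm.prodMk ((continuous_sres hD C).comp
      (continuous_id.matrix_transpose.neg))).measurable
  exact (measurable_extRatio.comp h1).min (measurable_extRatio.comp h2)

end RestrictedSingularValue

/-! ### The Gaussian space carrying both processes -/

section GaussianMarginals

theorem stdGaussian_map_comp_injective {ι κ : Type*} [Fintype ι] [Fintype κ] {e : κ → ι}
    (he : Function.Injective e) :
    (stdGaussian (EuclideanSpace ℝ ι)).map (fun x => WithLp.toLp 2 fun k => x (e k)) =
      stdGaussian (EuclideanSpace ℝ κ) := by
  have hm : Measurable fun x : EuclideanSpace ℝ ι => (WithLp.toLp 2 fun k => x (e k)) := by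
    fun_prop
  have := Measure.isProbabilityMeasure_map (μ := stdGaussian (EuclideanSpace ℝ ι))
    hm.aemeasurable
  refine Measure.ext_of_charFun (E := EuclideanSpace ℝ κ) ?_
  ext t
  -- Extension by zero preserves the norm and is adjoint to restriction of coordinates, so the two
  -- characteristic functions agree.
  set s : EuclideanSpace ℝ ι := WithLp.toLp 2 (Function.extend e t 0) with hs
  have h1 : ∀ x : EuclideanSpace ℝ ι,
      inner ℝ (WithLp.toLp 2 fun k => x (e k) : EuclideanSpace ℝ κ) t = (inner ℝ x s : ℝ) := by
    intro x
    simp only [PiLp.inner_apply, hs]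
    refine Fintype.sum_of_injective e he _ _ (fun i hi => ?_) fun k => ?_
    · rw [Function.extend_apply' _ _ _ (by simpa using hi)]
      simp
    · rw [he.extend_apply]
  have h2 : ‖s‖ ^ 2 = ‖t‖ ^ 2 := by
    simp only [EuclideanSpace.real_norm_sq_eq, hs]
    refine (Fintype.sum_of_injective e he _ _ (fun i hi => ?_) fun k => ?_).symm
    · rw [Function.extend_apply' _ _ _ (by simpa using hi)]
      simp
    · rw [he.extend_apply]
  rw [charFun_apply, integral_map hm.aemeasurable (by fun_prop)]
  simp_rw [h1]
  rw [← charFun_apply, charFun_stdGaussian, charFun_stdGaussian, ← Complex.ofReal_pow, h2,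
    Complex.ofReal_pow]

variable (n m : ℕ)

/-- The Euclidean space carrying a Gaussian matrix and two independent Gaussian vectors. -/
abbrev GordonSpace : Type := EuclideanSpace ℝ ((Fin n × Fin m) ⊕ (Fin n ⊕ Fin m))

variable {n m}

/-- The matrix component. -/
def gordonMatrix (ω : GordonSpace n m) : Matrix (Fin n) (Fin m) ℝ :=
  Matrix.of fun i j => ω (Sum.inl (i, j))

/-- The vector component in the target space. -/
def gordonLeft (ω : GordonSpace n m) : Euc n := WithLp.toLp 2 fun i => ω (Sum.inr (Sum.inl i))

/-- The vector component in the source space. -/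
def gordonRight (ω : GordonSpace n m) : Euc m := WithLp.toLp 2 fun j => ω (Sum.inr (Sum.inr j))

theorem measurable_gordonMatrix :
    Measurable (gordonMatrix : GordonSpace n m → Matrix (Fin n) (Fin m) ℝ) := by
  refine measurable_pi_lambda _ fun i => measurable_pi_lambda _ fun j => ?_
  change Measurable fun ω : GordonSpace n m => ω (Sum.inl (i, j))
  fun_prop

theorem measurable_gordonLeft : Measurable (gordonLeft : GordonSpace n m → Euc n) := by
  unfold gordonLeft
  fun_prop

theorem measurable_gordonRight : Measurable (gordonRight : GordonSpace n m → Euc m) := by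
  unfold gordonRight
  fun_prop

theorem map_gordonLeft :
    (stdGaussian (GordonSpace n m)).map gordonLeft = stdGaussian (Euc n) :=
  stdGaussian_map_comp_injective (Sum.inr_injective.comp Sum.inl_injective)

theorem map_gordonRight :
    (stdGaussian (GordonSpace n m)).map gordonRight = stdGaussian (Euc m) :=
  stdGaussian_map_comp_injective (Sum.inr_injective.comp Sum.inr_injective)

theorem map_gordonMatrix :
    (stdGaussian (GordonSpace n m)).map gordonMatrix = gaussianMatrix n m := by
  have h1 := stdGaussian_map_comp_injective (ι := (Fin n × Fin m) ⊕ (Fin n ⊕ Fin m))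
    (e := (Sum.inl : Fin n × Fin m → _)) Sum.inl_injective
  have h2 : (stdGaussian (EuclideanSpace ℝ (Fin n × Fin m))).map (WithLp.ofLp) =
      Measure.pi fun _ => gaussianReal 0 1 := by
    rw [← map_pi_eq_stdGaussian, Measure.map_map (by fun_prop) (by fun_prop)]
    exact Measure.map_id
  have h3 := Measure.infinitePi_map_curry (ι := Fin n) (κ := Fin m) (X := ℝ)
    (μ := fun _ _ => gaussianReal 0 1)
  simp only [Measure.infinitePi_eq_pi] at h3
  rw [← h2, ← h1, Measure.map_map (MeasurableEquiv.measurable _) (by fun_prop),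
    Measure.map_map ((MeasurableEquiv.measurable _).comp (by fun_prop)) (by fun_prop)] at h3
  exact h3

/-- The vector representing the functional `ω ↦ ⟪G x, y⟫`. -/
def bilinVec (x : Euc m) (y : Euc n) : GordonSpace n m :=
  WithLp.toLp 2 (Sum.elim (fun p => y p.1 * x p.2) 0)

/-- The vector representing the functional `ω ↦ ⟪h, y⟫ + ⟪g, x⟫`. -/
def sumVec (x : Euc m) (y : Euc n) : GordonSpace n m :=
  WithLp.toLp 2 (Sum.elim 0 (Sum.elim y x))

theorem inner_bilinVec_sumVec (x x' : Euc m) (y y' : Euc n) :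
    inner ℝ (bilinVec x y) (sumVec x' y') = (0 : ℝ) := by
  simp [PiLp.inner_apply, bilinVec, sumVec, Fintype.sum_sum_type]

theorem inner_bilinVec_bilinVec (x x' : Euc m) (y y' : Euc n) :
    inner ℝ (bilinVec x y) (bilinVec x' y') = (inner ℝ x x' * inner ℝ y y' : ℝ) := by
  simp only [PiLp.inner_apply, bilinVec, Fintype.sum_sum_type, Fintype.sum_prod_type, Sum.elim_inl,
    Sum.elim_inr, Pi.zero_apply, inner_zero_left, Finset.sum_const_zero, add_zero]
  rw [mul_comm, Finset.sum_mul_sum]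
  refine Finset.sum_congr rfl fun i _ => Finset.sum_congr rfl fun j _ => ?_
  simp
  ring

theorem inner_sumVec_sumVec (x x' : Euc m) (y y' : Euc n) :
    inner ℝ (sumVec x y) (sumVec x' y') = (inner ℝ y y' + inner ℝ x x' : ℝ) := by
  simp [PiLp.inner_apply, sumVec, Fintype.sum_sum_type]

theorem inner_sumVec (x : Euc m) (y : Euc n) (ω : GordonSpace n m) :
    inner ℝ (sumVec x y) ω = (inner ℝ (gordonLeft ω) y + inner ℝ (gordonRight ω) x : ℝ) := by
  simp [PiLp.inner_apply, sumVec, gordonLeft, gordonRight, Fintype.sum_sum_type, mul_comm]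

theorem inner_bilinVec (x : Euc m) (y : Euc n) (ω : GordonSpace n m) :
    inner ℝ (bilinVec x y) ω = (inner ℝ (matCLM (gordonMatrix ω) x) y : ℝ) := by
  simp only [PiLp.inner_apply, bilinVec, Fintype.sum_sum_type, Fintype.sum_prod_type, Sum.elim_inl,
    Sum.elim_inr, Pi.zero_apply, inner_zero_left, Finset.sum_const_zero, add_zero, matCLM_apply,
    Matrix.toLpLin_apply, Matrix.mulVec, dotProduct, gordonMatrix, Matrix.of_apply]
  refine Finset.sum_congr rfl fun i _ => ?_
  simp only [RCLike.inner_apply, conj_trivial, Finset.mul_sum]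
  refine Finset.sum_congr rfl fun j _ => ?_
  ring

end GaussianMarginals

/-! ### Moments of norms and of projected Gaussian vectors -/

section GaussianMoments

open Real

theorem integral_le_sqrt_integral_sq {Ω : Type*} [MeasurableSpace Ω] {μ : Measure Ω}
    [IsProbabilityMeasure μ] {f : Ω → ℝ} (hf : MemLp f 2 μ) :
    ∫ x, f x ∂μ ≤ √(∫ x, f x ^ 2 ∂μ) := by
  have h1 := variance_nonneg f μ
  rw [variance_eq_sub hf] at h1
  refine le_sqrt_of_sq_le ?_
  simp only [Pi.pow_apply] at h1
  linarith

variable {d : ℕ}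

theorem integrable_norm_sq_stdGaussian :
    Integrable (fun x : Euc d => ‖x‖ ^ 2) (stdGaussian (Euc d)) := by
  simpa using (IsGaussian.memLp_two_id (μ := stdGaussian (Euc d))).integrable_norm_pow (by norm_num)

theorem integrable_norm_stdGaussian :
    Integrable (fun x : Euc d => ‖x‖) (stdGaussian (Euc d)) :=
  (IsGaussian.integrable_id (μ := stdGaussian (Euc d))).norm

theorem integral_inner_sq_stdGaussian (u : Euc d) :
    ∫ x, inner ℝ u x ^ 2 ∂(stdGaussian (Euc d)) = ‖u‖ ^ 2 := by
  have := integral_strongDual_mul_inner_stdGaussian (innerSL ℝ u) u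
  simp only [innerSL_apply_apply ℝ, real_inner_self_eq_norm_sq] at this
  simpa only [sq] using this

theorem integral_norm_sq_stdGaussian : ∫ x, ‖x‖ ^ 2 ∂(stdGaussian (Euc d)) = d := by
  have h1 : ∀ x : Euc d, ‖x‖ ^ 2 = ∑ i, inner ℝ (EuclideanSpace.basisFun (Fin d) ℝ i) x ^ 2 := by
    intro x
    exact ((EuclideanSpace.basisFun (Fin d) ℝ).sum_sq_inner_right x).symm
  simp_rw [h1]
  rw [integral_finsetSum]
  · simp_rw [integral_inner_sq_stdGaussian]
    simp
  · intro i _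
    exact (IsGaussian.memLp_dual (stdGaussian (Euc d))
      (innerSL ℝ (EuclideanSpace.basisFun (Fin d) ℝ i)) 2 (by norm_num)).integrable_sq

theorem memLp_norm_stdGaussian : MemLp (fun x : Euc d => ‖x‖) 2 (stdGaussian (Euc d)) :=
  (IsGaussian.memLp_two_id (μ := stdGaussian (Euc d))).norm

theorem integral_norm_stdGaussian_le : ∫ x, ‖x‖ ∂(stdGaussian (Euc d)) ≤ √d := by
  rw [← integral_norm_sq_stdGaussian]
  exact integral_le_sqrt_integral_sq memLp_norm_stdGaussian

theorem memLp_norm_coneProj (C : ClosedConvexCone d) :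
    MemLp (fun x => ‖coneProj C x‖) 2 (stdGaussian (Euc d)) :=
  memLp_norm_stdGaussian.mono (continuous_norm_coneProj C).aestronglyMeasurable
    (ae_of_all _ fun x => by simpa using norm_coneProj_le C x)

theorem integral_norm_coneProj_le (C : ClosedConvexCone d) :
    ∫ x, ‖coneProj C x‖ ∂(stdGaussian (Euc d)) ≤ √(statDim C) :=
  integral_le_sqrt_integral_sq (memLp_norm_coneProj C)

/-- The mean squared difference of two independent copies is twice the variance; this is the form in
which the smooth variance bound is available. -/
theorem integral_sq_sub_prod {Ω : Type*} [MeasurableSpace Ω] {μ : Measure Ω}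
    [IsProbabilityMeasure μ] {f : Ω → ℝ} (hf : MemLp f 2 μ) :
    Integrable (fun p : Ω × Ω => (f p.2 - f p.1) ^ 2) (μ.prod μ) ∧
    ∫ p : Ω × Ω, (f p.2 - f p.1) ^ 2 ∂(μ.prod μ) =
      2 * (∫ x, f x ^ 2 ∂μ - (∫ x, f x ∂μ) ^ 2) := by
  have h1 : Integrable f μ := hf.integrable (by norm_num)
  have h2 : Integrable (fun x => f x ^ 2) μ := hf.integrable_sq
  have e : (fun p : Ω × Ω => (f p.2 - f p.1) ^ 2) = fun p : Ω × Ω =>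
      (f p.2 ^ 2 + f p.1 ^ 2) - 2 * (f p.1 * f p.2) := by
    ext p
    ring
  have i1 : Integrable (fun p : Ω × Ω => f p.2 ^ 2) (μ.prod μ) := h2.comp_snd μ
  have i2 : Integrable (fun p : Ω × Ω => f p.1 ^ 2) (μ.prod μ) := h2.comp_fst μ
  have i3 : Integrable (fun p : Ω × Ω => 2 * (f p.1 * f p.2)) (μ.prod μ) :=
    (h1.mul_prod h1).const_mul 2
  have i4 : Integrable (fun p : Ω × Ω => f p.2 ^ 2 + f p.1 ^ 2) (μ.prod μ) := i1.add i2
  rw [e]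
  refine ⟨i4.sub i3, ?_⟩
  rw [integral_sub i4 i3, integral_add i1 i2, integral_const_mul, integral_prod_mul,
    integral_fun_snd (fun x => f x ^ 2), integral_fun_fst (fun x => f x ^ 2)]
  simp only [probReal_univ, one_smul]
  ring

/-- A bound for the standard deviation of the length of the projection of a Gaussian vector. -/
noncomputable def projDeviation : ℝ := √(4 * exp (π ^ 2 / 8) + 16)

/-- The smooth maximum over a net of unit vectors of `D`, with `0` added because the maximum over
unit vectors alone can be negative while `‖Π_D x‖` cannot. Mesh `1 / d` keeps the second moment of
the net error bounded. -/
theorem exists_smooth_norm_coneProj {D : ClosedConvexCone d} (hD : D ≠ ⊥) :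
    ∃ f : Euc d → ℝ, Continuous f ∧ (∀ x, |‖coneProj D x‖ - f x| ≤ 1 + (d : ℝ)⁻¹ * ‖x‖) ∧
      ∫⁻ p, ENNReal.ofReal ((f p.2 - f p.1) ^ 2)
        ∂((stdGaussian (Euc d)).prod (stdGaussian (Euc d))) ≤
        ENNReal.ofReal (4 * exp (π ^ 2 / 8)) := by
  classical
  have hd : (1 : ℝ) ≤ d := by exact_mod_cast pos_of_cone_ne_bot hD
  obtain ⟨t, -, ht, hnet⟩ := exists_finite_net D hD (ε := (d : ℝ)⁻¹) (by positivity)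
  have : Nonempty (insert 0 t : Finset (Euc d)) := ⟨⟨0, Finset.mem_insert_self _ _⟩⟩
  obtain ⟨f, hfc, hfle, hlef, hfvar⟩ := exists_smooth_max (J := (insert 0 t : Finset (Euc d)))
    (a := fun j => j.1) (fun j => by
      rcases Finset.mem_insert.1 j.2 with h | h
      · rw [h, norm_zero]
        exact zero_le_one
      · exact (ht _ h).2.le)
  have hup : ∀ x, f x ≤ ‖coneProj D x‖ + 1 := by
    refine fun x => hfle x _ fun j => ?_
    rw [real_inner_comm]
    rcases Finset.mem_insert.1 j.2 with h | h
    · rw [h, inner_zero_right]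
      exact norm_nonneg _
    · exact inner_le_norm_coneProj D x (ht _ h).1 (ht _ h).2.le
  have hlow : ∀ x, ‖coneProj D x‖ - (d : ℝ)⁻¹ * ‖x‖ ≤ f x := by
    intro x
    by_cases hx : coneProj D x = 0
    · have := hlef x ⟨0, Finset.mem_insert_self _ _⟩
      rw [inner_zero_left] at this
      rw [hx, norm_zero]
      have : 0 ≤ (d : ℝ)⁻¹ * ‖x‖ := by positivity
      linarith
    · obtain ⟨z, hz, hz1, h⟩ := exists_unit_of_coneProj_ne_zero D hx
      obtain ⟨y, hy, hzy⟩ := hnet z hz hz1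
      have h1 := hlef x ⟨y, Finset.mem_insert_of_mem hy⟩
      have h2 := real_inner_le_norm x (z - y)
      rw [inner_sub_right, h, real_inner_comm y x] at h2
      have h3 := mul_le_mul_of_nonneg_left hzy (norm_nonneg x)
      simp only at h1
      linarith
  refine ⟨f, hfc, fun x => ?_, hfvar⟩
  have h0 : 0 ≤ (d : ℝ)⁻¹ * ‖x‖ := by positivity
  rw [abs_le]
  constructor
  · linarith [hup x]
  · linarith [hlow x]

theorem integral_one_add_norm_sq_le (c : ℝ) :
    Integrable (fun x : Euc d => (1 + c * ‖x‖) ^ 2) (stdGaussian (Euc d)) ∧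
      ∫ x : Euc d, (1 + c * ‖x‖) ^ 2 ∂(stdGaussian (Euc d)) ≤ 2 + 2 * c ^ 2 * d := by
  have hi : Integrable (fun x : Euc d => 2 * c ^ 2 * ‖x‖ ^ 2) (stdGaussian (Euc d)) :=
    integrable_norm_sq_stdGaussian.const_mul (2 * c ^ 2)
  have hi2 : Integrable (fun x : Euc d => 2 + 2 * c ^ 2 * ‖x‖ ^ 2) (stdGaussian (Euc d)) :=
    (integrable_const (2 : ℝ)).add hi
  have hle : ∀ x : Euc d, (1 + c * ‖x‖) ^ 2 ≤ 2 + 2 * c ^ 2 * ‖x‖ ^ 2 := by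
    intro x
    have := sq_nonneg (1 - c * ‖x‖)
    nlinarith
  have hei : Integrable (fun x : Euc d => (1 + c * ‖x‖) ^ 2) (stdGaussian (Euc d)) := by
    refine Integrable.mono' hi2 (Continuous.aestronglyMeasurable (by fun_prop))
      (ae_of_all _ fun x => ?_)
    rw [Real.norm_of_nonneg (sq_nonneg _)]
    exact hle x
  refine ⟨hei, (integral_mono hei hi2 hle).trans (le_of_eq ?_)⟩
  rw [integral_add (integrable_const _) hi, integral_const_mul, integral_norm_sq_stdGaussian]
  simp

/-- Converse to `integral_norm_coneProj_le`: `δ(D)` is the squared mean of `‖Π_D g‖` plus its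
variance, and that variance is at most `projDeviation ^ 2` in every dimension. -/
theorem sqrt_statDim_le {D : ClosedConvexCone d} (hD : D ≠ ⊥) :
    √(statDim D) ≤ ∫ x, ‖coneProj D x‖ ∂(stdGaussian (Euc d)) + projDeviation := by
  set μ := stdGaussian (Euc d)
  obtain ⟨f, hfc, hdiff, hfvar⟩ := exists_smooth_norm_coneProj hD
  obtain ⟨hei, heint⟩ := integral_one_add_norm_sq_le (d := d) (d : ℝ)⁻¹
  replace heint : ∫ x : Euc d, (1 + (d : ℝ)⁻¹ * ‖x‖) ^ 2 ∂μ ≤ 4 := by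
    have hd : (1 : ℝ) ≤ d := by exact_mod_cast pos_of_cone_ne_bot hD
    have h6 : 2 * (d : ℝ)⁻¹ ^ 2 * d = 2 * (d : ℝ)⁻¹ := by
      field_simp
    have h7 := inv_le_one_of_one_le₀ hd
    rw [h6] at heint
    linarith
  generalize he : (fun x : Euc d => 1 + (d : ℝ)⁻¹ * ‖x‖) = e at *
  replace he : ∀ x : Euc d, 1 + (d : ℝ)⁻¹ * ‖x‖ = e x := fun x => congrFun he x
  have hec : Continuous e := by
    have h : e = fun x => 1 + (d : ℝ)⁻¹ * ‖x‖ := funext fun x => (he x).symm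
    rw [h]
    fun_prop
  simp only [he] at hdiff hei heint
  have hpt : ∀ p : Euc d × Euc d, (‖coneProj D p.2‖ - ‖coneProj D p.1‖) ^ 2 ≤
      2 * (f p.2 - f p.1) ^ 2 + 4 * (e p.2 ^ 2 + e p.1 ^ 2) := by
    intro p
    have h1 := sq_le_sq' (abs_le.1 (hdiff p.1)).1 (abs_le.1 (hdiff p.1)).2
    have h2 := sq_le_sq' (abs_le.1 (hdiff p.2)).1 (abs_le.1 (hdiff p.2)).2
    set u := ‖coneProj D p.2‖ - f p.2
    set v := ‖coneProj D p.1‖ - f p.1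
    have h3 : ‖coneProj D p.2‖ - ‖coneProj D p.1‖ = (f p.2 - f p.1) + (u - v) := by
      simp only [u, v]
      ring
    rw [h3]
    nlinarith [sq_nonneg ((f p.2 - f p.1) - (u - v)), sq_nonneg (u + v)]
  obtain ⟨hint, hval⟩ := integral_sq_sub_prod (memLp_norm_coneProj D)
  have i1 : Integrable (fun p : Euc d × Euc d => e p.2 ^ 2) (μ.prod μ) := hei.comp_snd μ
  have i2 : Integrable (fun p : Euc d × Euc d => e p.1 ^ 2) (μ.prod μ) := hei.comp_fst μ
  have i3 : Integrable (fun p : Euc d × Euc d => 4 * (e p.2 ^ 2 + e p.1 ^ 2)) (μ.prod μ) :=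
    (i1.add i2).const_mul 4
  have hI3 : ∫ p : Euc d × Euc d, 4 * (e p.2 ^ 2 + e p.1 ^ 2) ∂(μ.prod μ) ≤ 32 := by
    rw [integral_const_mul, integral_add i1 i2, integral_fun_snd (fun x => e x ^ 2),
      integral_fun_fst (fun x => e x ^ 2)]
    simp only [probReal_univ, one_smul]
    linarith
  -- Twice the smooth bound `4 * exp (π ^ 2 / 8)`, plus `32` from the approximation error; half of
  -- this is `projDeviation ^ 2`.
  have hle : ENNReal.ofReal (∫ p : Euc d × Euc d,
      (‖coneProj D p.2‖ - ‖coneProj D p.1‖) ^ 2 ∂(μ.prod μ)) ≤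
      ENNReal.ofReal (8 * exp (π ^ 2 / 8) + 32) := by
    rw [ofReal_integral_eq_lintegral_ofReal hint (ae_of_all _ fun _ => sq_nonneg _)]
    calc _ ≤ ∫⁻ p : Euc d × Euc d, (ENNReal.ofReal 2 * ENNReal.ofReal ((f p.2 - f p.1) ^ 2) +
          ENNReal.ofReal (4 * (e p.2 ^ 2 + e p.1 ^ 2))) ∂(μ.prod μ) := by
          refine lintegral_mono fun p => ?_
          rw [← ENNReal.ofReal_mul zero_le_two, ← ENNReal.ofReal_add (by positivity)
            (by positivity)]
          exact ENNReal.ofReal_le_ofReal (hpt p)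
      _ = ENNReal.ofReal 2 * ∫⁻ p : Euc d × Euc d, ENNReal.ofReal ((f p.2 - f p.1) ^ 2)
          ∂(μ.prod μ) + ENNReal.ofReal (∫ p : Euc d × Euc d, 4 * (e p.2 ^ 2 + e p.1 ^ 2)
          ∂(μ.prod μ)) := by
          rw [lintegral_add_right _ (by fun_prop),
            lintegral_const_mul' _ _ ENNReal.ofReal_ne_top,
            ofReal_integral_eq_lintegral_ofReal i3 (ae_of_all _ fun _ => by positivity)]
      _ ≤ ENNReal.ofReal 2 * ENNReal.ofReal (4 * exp (π ^ 2 / 8)) + ENNReal.ofReal 32 :=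
          add_le_add (mul_le_mul_right hfvar _) (ENNReal.ofReal_le_ofReal hI3)
      _ = _ := by
          rw [← ENNReal.ofReal_mul zero_le_two, ← ENNReal.ofReal_add (by positivity)
            (by norm_num)]
          congr 1
          ring
  rw [ENNReal.ofReal_le_ofReal_iff (by positivity), hval] at hle
  have hK : projDeviation ^ 2 = 4 * exp (π ^ 2 / 8) + 16 := sq_sqrt (by positivity)
  have hK0 : 0 ≤ projDeviation := sqrt_nonneg _
  have hP0 : 0 ≤ ∫ x, ‖coneProj D x‖ ∂μ := integral_nonneg fun _ => norm_nonneg _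
  refine sqrt_le_iff.2 ⟨by positivity, ?_⟩
  rw [statDim]
  nlinarith [mul_nonneg hK0 hP0]

end GaussianMoments

/-! ### Tails of the restricted singular value and of the norm -/

section TailBounds

open Real

variable {n m : ℕ}

theorem integrable_comp_gordonLeft {f : Euc n → ℝ} (hf : Integrable f (stdGaussian (Euc n))) :
    Integrable (fun ω : GordonSpace n m => f (gordonLeft ω)) (stdGaussian (GordonSpace n m)) := by
  rw [← map_gordonLeft (n := n) (m := m)] at hf
  exact hf.comp_measurable measurable_gordonLeft

theorem integrable_comp_gordonRight {f : Euc m → ℝ} (hf : Integrable f (stdGaussian (Euc m))) :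
    Integrable (fun ω : GordonSpace n m => f (gordonRight ω)) (stdGaussian (GordonSpace n m)) := by
  rw [← map_gordonRight (n := n) (m := m)] at hf
  exact hf.comp_measurable measurable_gordonRight

theorem integral_comp_gordonLeft {f : Euc n → ℝ} (hf : Integrable f (stdGaussian (Euc n))) :
    ∫ ω : GordonSpace n m, f (gordonLeft ω) ∂(stdGaussian (GordonSpace n m)) =
      ∫ x, f x ∂(stdGaussian (Euc n)) := by
  rw [← map_gordonLeft (n := n) (m := m)] at hf ⊢
  rw [integral_map measurable_gordonLeft.aemeasurable hf.aestronglyMeasurable]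

theorem integral_comp_gordonRight {f : Euc m → ℝ} (hf : Integrable f (stdGaussian (Euc m))) :
    ∫ ω : GordonSpace n m, f (gordonRight ω) ∂(stdGaussian (GordonSpace n m)) =
      ∫ x, f x ∂(stdGaussian (Euc m)) := by
  rw [← map_gordonRight (n := n) (m := m)] at hf ⊢
  rw [integral_map measurable_gordonRight.aemeasurable hf.aestronglyMeasurable]

theorem one_sub_inner_nonneg {d : ℕ} {x y : Euc d} (hx : ‖x‖ = 1) (hy : ‖y‖ = 1) :
    0 ≤ 1 - (inner ℝ x y : ℝ) := by
  have := real_inner_le_norm x y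
  rw [hx, hy] at this
  linarith

theorem inner_self_of_norm_one {d : ℕ} {x : Euc d} (hx : ‖x‖ = 1) : (inner ℝ x x : ℝ) = 1 := by
  rw [real_inner_self_eq_norm_sq, hx, one_pow]

theorem norm_bilinVec_le {x : Euc m} {y : Euc n} (hx : ‖x‖ = 1) (hy : ‖y‖ = 1) :
    ‖(bilinVec x y : GordonSpace n m)‖ ≤ 1 := by
  have h : ‖(bilinVec x y : GordonSpace n m)‖ ^ 2 = 1 := by
    rw [← real_inner_self_eq_norm_sq, inner_bilinVec_bilinVec, inner_self_of_norm_one hx,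
      inner_self_of_norm_one hy, one_mul]
  nlinarith [norm_nonneg (bilinVec x y : GordonSpace n m)]

/-- Lower tail of the restricted singular value of a Gaussian matrix. -/
theorem gaussianMatrix_sres_le {C : ClosedConvexCone m} {D : ClosedConvexCone n} (hC : C ≠ ⊥)
    (hD : D ≠ ⊥) {M t : ℝ} (hM : 0 < M) (ht : 0 ≤ t) :
    gaussianMatrix n m {A | matOpNorm A ≤ M ∧
      sres A C D ≤ √(statDim D) - √(statDim C) - (projDeviation + 5) - t} ≤
      ENNReal.ofReal (exp (-(2 * t ^ 2 / π ^ 2))) := by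
  have hn : (1 : ℝ) ≤ n := by exact_mod_cast pos_of_cone_ne_bot hD
  -- Moving `x` to the net of mesh `1 / M` changes `A x` by at most `1` when the norm of `A` is at
  -- most `M`.
  obtain ⟨s, ⟨x₀, hx₀⟩, hs, hsnet⟩ := exists_finite_net C hC (ε := M⁻¹) (by positivity)
  obtain ⟨r, ⟨y₀, hy₀⟩, hr, hrnet⟩ := exists_finite_net D hD (ε := (n : ℝ)⁻¹) (by positivity)
  have : Nonempty s := ⟨⟨x₀, hx₀⟩⟩
  have : Nonempty r := ⟨⟨y₀, hy₀⟩⟩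
  set μ := stdGaussian (GordonSpace n m)
  have iD : Integrable (fun x => ‖coneProj D x‖) (stdGaussian (Euc n)) :=
    (memLp_norm_coneProj D).integrable (by norm_num)
  have iC : Integrable (fun x => ‖coneProj C x‖) (stdGaussian (Euc m)) :=
    (memLp_norm_coneProj C).integrable (by norm_num)
  have iN : Integrable (fun x : Euc n => (n : ℝ)⁻¹ * ‖x‖) (stdGaussian (Euc n)) :=
    integrable_norm_stdGaussian.const_mul _
  have iY : Integrable (fun x : Euc n => |inner ℝ y₀ x|) (stdGaussian (Euc n)) :=
    (IsGaussian.integrable_dual (stdGaussian (Euc n)) (innerSL ℝ y₀)).abs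
  -- A lower bound for the maximum of `⟪x, y⟫` over the net of `D`. The last term covers the case
  -- `Π_D x = 0`, where that maximum may be negative and `y₀` is used. Each of the two corrections
  -- has mean at most `1`.
  let f : Euc n → ℝ := fun x => ‖coneProj D x‖ - (n : ℝ)⁻¹ * ‖x‖ - |inner ℝ y₀ x|
  have iDN : Integrable (fun x => ‖coneProj D x‖ - (n : ℝ)⁻¹ * ‖x‖) (stdGaussian (Euc n)) :=
    iD.sub iN
  have if' : Integrable f (stdGaussian (Euc n)) := iDN.sub iY
  let l : GordonSpace n m → ℝ := fun ω => f (gordonLeft ω) - ‖coneProj C (gordonRight ω)‖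
  have i1 := integrable_comp_gordonLeft (m := m) if'
  have i2 := integrable_comp_gordonRight (n := n) iC
  have il : Integrable l μ := i1.sub i2
  have hmean : √(statDim D) - √(statDim C) - (projDeviation + 2) ≤ ∫ ω, l ω ∂μ := by
    have e1 : ∫ ω, l ω ∂μ = ∫ x, f x ∂(stdGaussian (Euc n)) -
        ∫ x, ‖coneProj C x‖ ∂(stdGaussian (Euc m)) := by
      simp only [l]
      rw [integral_sub i1 i2, integral_comp_gordonLeft if', integral_comp_gordonRight iC]
    have e2 : ∫ x, f x ∂(stdGaussian (Euc n)) = ∫ x, ‖coneProj D x‖ ∂(stdGaussian (Euc n)) -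
        (n : ℝ)⁻¹ * ∫ x : Euc n, ‖x‖ ∂(stdGaussian (Euc n)) -
        ∫ x : Euc n, |inner ℝ y₀ x| ∂(stdGaussian (Euc n)) := by
      simp only [f]
      rw [integral_sub iDN iY, integral_sub iD iN, integral_const_mul]
    have e3 := sqrt_statDim_le hD
    have e4 := integral_norm_coneProj_le C
    have e5 : (n : ℝ)⁻¹ * ∫ x : Euc n, ‖x‖ ∂(stdGaussian (Euc n)) ≤ 1 := by
      rw [inv_mul_le_iff₀ (by linarith), mul_one]
      refine integral_norm_stdGaussian_le.trans ?_
      rw [sqrt_le_iff]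
      constructor <;> nlinarith
    have e6 : ∫ x : Euc n, |inner ℝ y₀ x| ∂(stdGaussian (Euc n)) ≤ 1 := by
      have hL : MemLp (fun x : Euc n => |inner ℝ y₀ x|) 2 (stdGaussian (Euc n)) :=
        (IsGaussian.memLp_dual (stdGaussian (Euc n)) (innerSL ℝ y₀) 2 (by norm_num)).abs
      have := integral_le_sqrt_integral_sq hL
      simp only [sq_abs] at this
      rw [integral_inner_sq_stdGaussian, (hr y₀ hy₀).2] at this
      simpa using this
    rw [e1, e2]
    linarith
  have key := stdGaussian_minMax_le (E := GordonSpace n m) (I := s) (J := r)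
    -- The sign makes the comparison process `⟪h, y⟫ - ⟪g, x⟫`, bounded below in `x` by `-‖Π_C g‖`.
    -- For unit vectors and `c = 1` the covariance gap is `(1 - ⟪x, x'⟫) * (1 - ⟪y, y'⟫)`, which
    -- vanishes when `x = x'`.
    (a := fun p => bilinVec p.1.1 p.2.1) (b := fun p => sumVec (-p.1.1) p.2.1)
    (fun p q => inner_bilinVec_sumVec _ _ _ _)
    (fun p => norm_bilinVec_le (hs _ p.1.2).2 (hr _ p.2.2).2) (c := 1)
    (fun i j j' => by
      simp only [inner_bilinVec_bilinVec, inner_sumVec_sumVec, inner_neg_neg,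
        inner_self_of_norm_one (hs _ i.2).2]
      ring)
    (fun p q => by
      simp only [inner_bilinVec_bilinVec, inner_sumVec_sumVec, inner_neg_neg]
      have h1 := one_sub_inner_nonneg (hs _ p.1.2).2 (hs _ q.1.2).2
      have h2 := one_sub_inner_nonneg (hr _ p.2.2).2 (hr _ q.2.2).2
      nlinarith [mul_nonneg h1 h2]) il
    (fun ω i => by
      simp only [inner_sumVec, inner_neg_right, l, f]
      have hg := inner_le_norm_coneProj C (gordonRight ω) (hs _ i.2).1 (hs _ i.2).2.le
      have hN : 0 ≤ (n : ℝ)⁻¹ * ‖gordonLeft ω‖ := by positivity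
      by_cases hx : coneProj D (gordonLeft ω) = 0
      · refine ⟨⟨y₀, hy₀⟩, ?_⟩
        have := neg_abs_le (inner ℝ y₀ (gordonLeft ω) : ℝ)
        rw [hx, norm_zero]
        simp only
        rw [real_inner_comm y₀ (gordonLeft ω)]
        linarith
      · obtain ⟨z, hz, hz1, h⟩ := exists_unit_of_coneProj_ne_zero D hx
        obtain ⟨y, hy, hzy⟩ := hrnet z hz hz1
        refine ⟨⟨y, hy⟩, ?_⟩
        have h2 := real_inner_le_norm (gordonLeft ω) (z - y)
        rw [inner_sub_right, h] at h2
        have h3 := mul_le_mul_of_nonneg_left hzy (norm_nonneg (gordonLeft ω))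
        have h4 := abs_nonneg (inner ℝ y₀ (gordonLeft ω) : ℝ)
        simp only
        linarith) ht
  rw [← map_gordonMatrix, Measure.map_apply measurable_gordonMatrix]
  · refine (measure_mono ?_).trans key
    rintro ω ⟨hω1, hω2⟩
    set A := gordonMatrix ω
    -- The constant `5` splits as `2` from the mean of `l`, `1` from smoothing, `1` from the net of
    -- `C`, and `1` spare for a strict inequality without attaining the infimum.
    have hex : ∃ x ∈ C, ‖x‖ = 1 ∧ ‖coneProj D (matCLM A x)‖ < ∫ y, l y ∂μ - t - 2 := by
      by_contra! hcon
      have := le_sres A hC D hcon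
      linarith
    obtain ⟨x, hx, hx1, hlt⟩ := hex
    obtain ⟨x', hx', hxx⟩ := hsnet x hx hx1
    refine ⟨⟨x', hx'⟩, fun j => ?_⟩
    rw [inner_bilinVec]
    have h1 := inner_le_norm_coneProj D (matCLM A x') (hr _ j.2).1 (hr _ j.2).2.le
    have h2 := norm_coneProj_le_add D (matCLM A x') (matCLM A x)
    rw [← map_sub] at h2
    have h3 := (matCLM A).le_opNorm (x' - x)
    rw [← matOpNorm_eq, norm_sub_rev] at h3
    have h4 : matOpNorm A * ‖x - x'‖ ≤ M * M⁻¹ :=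
      mul_le_mul hω1 hxx (norm_nonneg _) hM.le
    rw [mul_inv_cancel₀ hM.ne'] at h4
    linarith
  · exact (measurableSet_le continuous_matOpNorm.measurable measurable_const).inter
      (measurableSet_le (continuous_sres hC D).measurable measurable_const)

/-- Upper tail of the operator norm of a Gaussian matrix. -/
theorem gaussianMatrix_lt_matOpNorm (hn : 0 < n) (hm : 0 < m) {t : ℝ} (ht : 0 ≤ t) :
    gaussianMatrix n m {A | √n + √m + t + 2 < matOpNorm A} ≤
      ENNReal.ofReal (exp (-(2 * t ^ 2 / π ^ 2))) := by
  have htop : ∀ {d : ℕ}, 0 < d → (⊤ : ClosedConvexCone d) ≠ ⊥ := by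
    intro d hd h
    have h1 : EuclideanSpace.single (⟨0, hd⟩ : Fin d) (1 : ℝ) ∈ (⊤ : ClosedConvexCone d) :=
      Submodule.mem_top
    rw [h] at h1
    have h2 : EuclideanSpace.single (⟨0, hd⟩ : Fin d) (1 : ℝ) = 0 := h1
    have h3 := congrArg norm h2
    simp at h3
  set R := √n + √m + t + 1 with hR
  have hR0 : 0 < R := by positivity
  -- With this mesh on both spheres, the two replacements cost `‖A‖ / (R + 1)` in total, and `‖A‖ ≤
  -- R + ‖A‖ / (R + 1)` forces `‖A‖ ≤ R + 1`.
  obtain ⟨s, ⟨x₀, hx₀⟩, hs, hsnet⟩ := exists_finite_net ⊤ (htop hm) (ε := (2 * (R + 1))⁻¹)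
    (by positivity)
  obtain ⟨r, ⟨y₀, hy₀⟩, hr, hrnet⟩ := exists_finite_net ⊤ (htop hn) (ε := (2 * (R + 1))⁻¹)
    (by positivity)
  have : Nonempty s := ⟨⟨x₀, hx₀⟩⟩
  have : Nonempty r := ⟨⟨y₀, hy₀⟩⟩
  set μ := stdGaussian (GordonSpace n m)
  let l : GordonSpace n m → ℝ := fun ω => -‖gordonLeft ω‖ - ‖gordonRight ω‖
  have i1 := integrable_comp_gordonLeft (m := m) (integrable_norm_stdGaussian (d := n))
  have i2 := integrable_comp_gordonRight (n := n) (integrable_norm_stdGaussian (d := m))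
  have i3 : Integrable (fun ω : GordonSpace n m => -‖gordonLeft ω‖)
      (stdGaussian (GordonSpace n m)) := i1.neg
  have il : Integrable l μ := i3.sub i2
  have hmean : -√n - √m ≤ ∫ ω, l ω ∂μ := by
    have e1 : ∫ ω, l ω ∂μ = -∫ x : Euc n, ‖x‖ ∂(stdGaussian (Euc n)) -
        ∫ x : Euc m, ‖x‖ ∂(stdGaussian (Euc m)) := by
      simp only [l]
      rw [integral_sub i3 i2, integral_neg,
        integral_comp_gordonLeft (integrable_norm_stdGaussian (d := n)),
        integral_comp_gordonRight (integrable_norm_stdGaussian (d := m))]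
    have e2 := integral_norm_stdGaussian_le (d := n)
    have e3 := integral_norm_stdGaussian_le (d := m)
    rw [e1]
    linarith
  -- With a single column the min-max is a pure minimum, and the minimum of `⟪G x, y⟫` over both
  -- spheres is `-‖G‖`.
  have key := stdGaussian_minMax_le (E := GordonSpace n m) (I := s × r) (J := Unit)
    (a := fun p => bilinVec p.1.1.1 p.1.2.1) (b := fun p => sumVec p.1.1.1 p.1.2.1)
    (fun p q => inner_bilinVec_sumVec _ _ _ _)
    (fun p => norm_bilinVec_le (hs _ p.1.1.2).2 (hr _ p.1.2.2).2) (c := 1)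
    (fun i j j' => by
      simp only [inner_bilinVec_bilinVec, inner_sumVec_sumVec,
        inner_self_of_norm_one (hs _ i.1.2).2, inner_self_of_norm_one (hr _ i.2.2).2]
      ring)
    (fun p q => by
      simp only [inner_bilinVec_bilinVec, inner_sumVec_sumVec]
      have h1 := one_sub_inner_nonneg (hs _ p.1.1.2).2 (hs _ q.1.1.2).2
      have h2 := one_sub_inner_nonneg (hr _ p.1.2.2).2 (hr _ q.1.2.2).2
      nlinarith [mul_nonneg h1 h2]) il
    (fun ω i => ⟨(), by
      simp only [inner_sumVec, l]
      have h1 := abs_real_inner_le_norm (gordonLeft ω) i.2.1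
      have h2 := abs_real_inner_le_norm (gordonRight ω) i.1.1
      rw [(hr _ i.2.2).2, mul_one] at h1
      rw [(hs _ i.1.2).2, mul_one] at h2
      have h3 := neg_abs_le (inner ℝ (gordonLeft ω) i.2.1 : ℝ)
      have h4 := neg_abs_le (inner ℝ (gordonRight ω) i.1.1 : ℝ)
      linarith⟩) ht
  rw [← map_gordonMatrix, Measure.map_apply measurable_gordonMatrix]
  · refine (measure_mono ?_).trans key
    intro ω hω
    by_contra hcon
    simp only [Set.mem_ofPred_eq, not_exists, not_forall, not_le] at hcon
    simp only [Set.mem_preimage, Set.mem_ofPred_eq] at hω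
    set A := gordonMatrix ω
    have hall : ∀ x ∈ s, ∀ y ∈ r, -R < inner ℝ (matCLM A x) y := by
      intro x hx y hy
      obtain ⟨-, h⟩ := hcon (⟨x, hx⟩, ⟨y, hy⟩)
      rw [inner_bilinVec] at h
      simp only at h
      linarith
    have hA0 := norm_nonneg (matCLM A)
    have hR1 : ‖matCLM A‖ * (2 * (R + 1))⁻¹ * 2 = ‖matCLM A‖ * (R + 1)⁻¹ := by
      field_simp
    have hunit : ∀ x : Euc m, ‖x‖ = 1 →
        ‖matCLM A x‖ ≤ R + ‖matCLM A‖ * (R + 1)⁻¹ := by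
      intro x hx
      by_cases h0 : matCLM A x = 0
      · rw [h0, norm_zero]
        positivity
      have hn0 : ‖matCLM A x‖ ≠ 0 := norm_ne_zero_iff.2 h0
      set z := -(‖matCLM A x‖⁻¹ • matCLM A x) with hz
      have hz1 : ‖z‖ = 1 := by
        rw [hz, norm_neg, norm_smul, norm_inv, norm_norm, inv_mul_cancel₀ hn0]
      have hzi : inner ℝ (matCLM A x) z = -‖matCLM A x‖ := by
        rw [hz, inner_neg_right, real_inner_smul_right, real_inner_self_eq_norm_sq]
        field_simp
      obtain ⟨x', hx', hxx⟩ := hsnet x Submodule.mem_top hx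
      obtain ⟨y, hy, hyy⟩ := hrnet z Submodule.mem_top hz1
      have h1 := hall x' hx' y hy
      have e : (inner ℝ (matCLM A x') y : ℝ) = inner ℝ (matCLM A x) z -
          inner ℝ (matCLM A (x - x')) z - inner ℝ (matCLM A x') (z - y) := by
        rw [map_sub, inner_sub_left, inner_sub_right]
        ring
      have h2 := neg_le_of_abs_le (abs_real_inner_le_norm (matCLM A (x - x')) z)
      have h3 := neg_le_of_abs_le (abs_real_inner_le_norm (matCLM A x') (z - y))
      have h4 := (matCLM A).le_opNorm (x - x')
      have h5 := (matCLM A).le_opNorm x'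
      rw [(hs _ hx').2, mul_one] at h5
      have h6 : ‖matCLM A‖ * ‖x - x'‖ ≤ ‖matCLM A‖ * (2 * (R + 1))⁻¹ := by gcongr
      have h7 : ‖matCLM A x'‖ * ‖z - y‖ ≤ ‖matCLM A‖ * (2 * (R + 1))⁻¹ := by gcongr
      rw [hz1, mul_one] at h2
      linarith
    have hop : ‖matCLM A‖ ≤ R + ‖matCLM A‖ * (R + 1)⁻¹ := by
      refine ContinuousLinearMap.opNorm_le_of_unit_norm (by positivity) fun x hx => hunit x hx
    have h8 : ‖matCLM A‖ * (R + 1)⁻¹ * (R + 1) = ‖matCLM A‖ := by field_simp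
    rw [matOpNorm_eq] at hω
    have h9 : R + 1 < ‖matCLM A‖ := by linarith
    nlinarith
  · exact measurableSet_lt measurable_const continuous_matOpNorm.measurable

end TailBounds

/-! ### A well-conditioned matrix for every pair of cones -/

section WellConditioned

variable {n m : ℕ}

/-- By compactness the minimum is attained, and `Π_D (A x) = 0` would put `A x` in the polar cone of
`D`. -/
theorem sres_pos {A : Matrix (Fin n) (Fin m) ℝ} {C : ClosedConvexCone m} (hC : C ≠ ⊥)
    {D : ClosedConvexCone n}
    (h : ∀ x ∈ C, x ≠ 0 → ∃ d ∈ D, 0 < (inner ℝ (matCLM A x) d : ℝ)) : 0 < sres A C D := by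
  obtain ⟨x₀, hx₀, hx₀1⟩ := exists_unit_mem hC
  have hcomp : IsCompact ((C : Set (Euc m)) ∩ Metric.sphere 0 1) :=
    (isCompact_sphere (0 : Euc m) 1).inter_left C.isClosed
  obtain ⟨x, ⟨hxC, hx1⟩, hmin⟩ := hcomp.exists_isMinOn ⟨x₀, hx₀, by simpa using hx₀1⟩
    (f := fun x => ‖coneProj D (matCLM A x)‖)
    (((continuous_norm_coneProj D).comp (matCLM A).continuous).continuousOn)
  have hx1' : ‖x‖ = 1 := by simpa using hx1
  have hpos : 0 < ‖coneProj D (matCLM A x)‖ := by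
    rw [norm_pos_iff]
    intro h0
    obtain ⟨d, hd, hlt⟩ := h x hxC (by
      intro h
      rw [h, norm_zero] at hx1'
      norm_num at hx1')
    have := inner_sub_coneProj_le D (matCLM A x) hd
    rw [h0, sub_zero] at this
    linarith
  refine hpos.trans_le (le_sres A hC D fun y hy hy1 => ?_)
  exact hmin ⟨hy, by simpa using hy1⟩

/-- The lineality space of a closed convex cone. -/
def linealitySpace (C : ClosedConvexCone n) : Submodule ℝ (Euc n) where
  carrier := {x | x ∈ C ∧ -x ∈ C}
  add_mem' := fun {x y} hx hy => ⟨C.add_mem hx.1 hy.1, by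
    rw [neg_add]
    exact C.add_mem hx.2 hy.2⟩
  zero_mem' := ⟨C.zero_mem, by rw [neg_zero]; exact C.zero_mem⟩
  smul_mem' := fun c x hx => by
    rcases le_total 0 c with hc | hc
    · refine ⟨C.smul_mem hx.1 hc, ?_⟩
      rw [← smul_neg]
      exact C.smul_mem hx.2 hc
    · have hc' : 0 ≤ -c := neg_nonneg.2 hc
      refine ⟨?_, ?_⟩
      · have := C.smul_mem hx.2 hc'
        rwa [smul_neg, neg_smul, neg_neg] at this
      · have := C.smul_mem hx.1 hc'
        rwa [neg_smul] at this

theorem mem_linealitySpace {C : ClosedConvexCone n} {x : Euc n} :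
    x ∈ linealitySpace C ↔ x ∈ C ∧ -x ∈ C := Iff.rfl

/-- A closed convex cone has a supporting functional that vanishes only on its lineality space. -/
theorem exists_supporting (C : ClosedConvexCone m) :
    ∃ u : Euc m, (∀ x ∈ C, 0 ≤ (inner ℝ u x : ℝ)) ∧
      ∀ x ∈ C, (inner ℝ u x : ℝ) = 0 → x ∈ linealitySpace C := by
  set K := ProperCone.innerDual (C : Set (Euc m)) with hK
  -- The functional is the sum of a basis of `span K` taken from the dual cone `K`. If it vanishes
  -- at a point of `C`, each nonnegative summand does, hence all of `K` does, and the bipolar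
  -- theorem puts `-x` in `C`.
  obtain ⟨b, hbK, hbspan, hbind⟩ := exists_linearIndependent ℝ (K : Set (Euc m))
  have hfin : b.Finite := hbind.setFinite
  have hmem : ∀ w ∈ K, ∀ x ∈ C, 0 ≤ (inner ℝ w x : ℝ) := by
    intro w hw x hx
    rw [real_inner_comm]
    exact ProperCone.mem_innerDual.1 hw hx
  have hsum : ∀ x, (inner ℝ (∑ w ∈ hfin.toFinset, w) x : ℝ) =
      ∑ w ∈ hfin.toFinset, (inner ℝ w x : ℝ) := fun x => sum_inner _ _ _
  refine ⟨∑ w ∈ hfin.toFinset, w, fun x hx => ?_, fun x hx h0 => ?_⟩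
  · rw [hsum]
    exact Finset.sum_nonneg fun w hw => hmem w (hbK (hfin.mem_toFinset.1 hw)) x hx
  · rw [hsum, Finset.sum_eq_zero_iff_of_nonneg fun w hw =>
      hmem w (hbK (hfin.mem_toFinset.1 hw)) x hx] at h0
    refine mem_linealitySpace.2 ⟨hx, ?_⟩
    rw [← ProperCone.innerDual_innerDual C]
    refine ProperCone.mem_innerDual.2 fun w hw => ?_
    have hw' : w ∈ Submodule.span ℝ b := by
      rw [hbspan]
      exact Submodule.subset_span hw
    have hz : (inner ℝ w x : ℝ) = 0 := by
      clear hw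
      induction hw' using Submodule.span_induction with
      | mem y hy => exact h0 y (hfin.mem_toFinset.2 hy)
      | zero => exact inner_zero_left _
      | add y z _ _ hy hz => rw [inner_add_left, hy, hz, add_zero]
      | smul c y _ hy => rw [real_inner_smul_left, hy, mul_zero]
    rw [inner_neg_right, hz, neg_zero]

theorem exists_matCLM_eq (f : Euc m →ₗ[ℝ] Euc n) :
    ∃ A : Matrix (Fin n) (Fin m) ℝ, ∀ x, matCLM A x = f x :=
  ⟨Matrix.toEuclideanLin.symm f, fun x => by rw [matCLM_apply, LinearEquiv.apply_symm_apply]⟩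

theorem inner_matCLM_neg_transpose (A : Matrix (Fin n) (Fin m) ℝ) (x : Euc m) (y : Euc n) :
    inner ℝ (matCLM (-A.transpose) y) x = -(inner ℝ (matCLM A x) y : ℝ) := by
  have h : matCLM (-A.transpose) y = -LinearMap.adjoint (Matrix.toEuclideanLin A) y := by
    rw [← Matrix.toEuclideanLin_conjTranspose_eq_adjoint, Matrix.conjTranspose_eq_transpose_of_trivial,
      matCLM_apply, map_neg]
    rfl
  rw [h, inner_neg_left, LinearMap.adjoint_inner_left, real_inner_comm, matCLM_apply]

/-- An injection of lineality spaces, composed with the orthogonal projection, gives `f`, which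
handles the lineality space of `C`. Other vectors of `C` are handled by a rank-one term in a
direction of `D` orthogonal to the range of `f`; if `D` lies in that range, `f` itself works for the
transposed problem. -/
theorem exists_sres_pos_of_finrank_le {C : ClosedConvexCone m} {D : ClosedConvexCone n}
    (hC : C ≠ ⊥) (hD : D ≠ ⊥)
    (h : Module.finrank ℝ (linealitySpace C) ≤ Module.finrank ℝ (linealitySpace D)) :
    ∃ A : Matrix (Fin n) (Fin m) ℝ, 0 < sres A C D ∨ 0 < sres (-A.transpose) D C := by
  obtain ⟨J, hJ⟩ := finrank_le_iff_exists_linearMap.1 h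
  let P : Euc m →ₗ[ℝ] linealitySpace C := (linealitySpace C).orthogonalProjectionOnto.toLinearMap
  have hP : ∀ (x : Euc m) (hx : x ∈ linealitySpace C), P x = ⟨x, hx⟩ := fun x hx =>
    Submodule.orthogonalProjectionOnto_mem_subspace_eq_self (K := linealitySpace C) ⟨x, hx⟩
  let f : Euc m →ₗ[ℝ] Euc n := (linealitySpace D).subtype.comp (J.comp P)
  have hfL : ∀ x ∈ linealitySpace C, x ≠ 0 → f x ≠ 0 := by
    intro x hx hx0 h0
    have h1 : J (P x) = 0 := Subtype.ext h0
    rw [← map_zero J] at h1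
    have h2 := hJ h1
    rw [hP x hx] at h2
    exact hx0 (congrArg Subtype.val h2)
  have hfD : ∀ x, f x ∈ linealitySpace D := fun x => (J (P x)).2
  by_cases hcase : ∀ y ∈ D, y ∈ LinearMap.range f
  · obtain ⟨A, hA⟩ := exists_matCLM_eq f
    refine ⟨A, Or.inr (sres_pos hD fun y hy hy0 => ?_)⟩
    obtain ⟨x, hx⟩ := hcase y hy
    have hPx : f (P x : Euc m) = y := by
      rw [← hx]
      change ((J (P (P x : Euc m)) : linealitySpace D) : Euc n) = (J (P x) : linealitySpace D)
      rw [hP _ (P x).2]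
    -- The preimage of `y` can be taken in the lineality space, so its negative is still in `C`; the
    -- two signs cancel to give `‖y‖ ^ 2`.
    refine ⟨-(P x : Euc m), (P x).2.2, ?_⟩
    rw [inner_matCLM_neg_transpose, map_neg, inner_neg_left, neg_neg, hA, hPx,
      real_inner_self_eq_norm_sq]
    have := norm_pos_iff.2 hy0
    positivity
  · push Not at hcase
    obtain ⟨y, hyD, hy⟩ := hcase
    set R := LinearMap.range f with hR
    set d := y - R.starProjection y with hd
    have hd0 : d ≠ 0 := by
      intro h0
      rw [hd, sub_eq_zero] at h0
      exact hy (h0 ▸ R.starProjection_apply_mem y)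
    have hRD : ∀ z ∈ R, -z ∈ D := by
      rintro _ ⟨x, rfl⟩
      exact (hfD x).2
    -- The range of `f` lies in the lineality space of `D`, so subtracting a vector of it does not
    -- leave `D`.
    have hdD : d ∈ D := by
      rw [hd, sub_eq_add_neg]
      exact D.add_mem hyD (hRD _ (R.starProjection_apply_mem y))
    have hdR : ∀ x, (inner ℝ (f x) d : ℝ) = 0 := fun x =>
      (Submodule.mem_orthogonal _ _).1 (Submodule.sub_starProjection_mem_orthogonal y) _
        (LinearMap.mem_range_self f x)
    obtain ⟨u, hu0, hu⟩ := exists_supporting C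
    obtain ⟨A, hA⟩ := exists_matCLM_eq (f + (innerₛₗ ℝ u).smulRight d)
    have hA' : ∀ x, matCLM A x = f x + (inner ℝ u x : ℝ) • d := hA
    refine ⟨A, Or.inl (sres_pos hC fun x hx hx0 => ?_)⟩
    rcases (hu0 x hx).lt_or_eq with hpos | hzero
    · refine ⟨d, hdD, ?_⟩
      rw [hA', inner_add_left, hdR, zero_add, real_inner_smul_left, real_inner_self_eq_norm_sq]
      have := norm_pos_iff.2 hd0
      positivity
    · refine ⟨f x, (hfD x).1, ?_⟩
      rw [hA', ← hzero, zero_smul, add_zero, real_inner_self_eq_norm_sq]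
      have := norm_pos_iff.2 (hfL x (hu x hx hzero.symm) hx0)
      positivity

theorem exists_sres_pos {C : ClosedConvexCone m} {D : ClosedConvexCone n}
    (hC : C ≠ ⊥) (hD : D ≠ ⊥) :
    ∃ A : Matrix (Fin n) (Fin m) ℝ, 0 < sres A C D ∨ 0 < sres (-A.transpose) D C := by
  rcases le_total (Module.finrank ℝ (linealitySpace C)) (Module.finrank ℝ (linealitySpace D))
    with h | h
  · exact exists_sres_pos_of_finrank_le hC hD h
  · obtain ⟨B, hB⟩ := exists_sres_pos_of_finrank_le hD hC h
    refine ⟨-B.transpose, ?_⟩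
    rw [Matrix.transpose_neg, Matrix.transpose_transpose, neg_neg]
    exact hB.symm

instance gaussianMatrix_isProbabilityMeasure : IsProbabilityMeasure (gaussianMatrix n m) :=
  inferInstanceAs (IsProbabilityMeasure
    (Measure.pi (fun _ : Fin n => Measure.pi (fun _ : Fin m => gaussianReal 0 1))))

instance gaussianMatrix_isOpenPosMeasure : (gaussianMatrix n m).IsOpenPosMeasure := by
  have : (gaussianReal 0 1).IsOpenPosMeasure :=
    (gaussianReal_absolutelyContinuous' 0 one_ne_zero).isOpenPosMeasure
  have h : (Measure.pi fun _ : Fin m => gaussianReal 0 1).IsOpenPosMeasure :=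
    Measure.pi.isOpenPosMeasure _
  exact Measure.pi.isOpenPosMeasure (fun _ : Fin n => Measure.pi fun _ : Fin m => gaussianReal 0 1)

theorem extRatio_le {a s b r : ℝ} (hr : 0 < r) (hs : r ≤ s) (hab : a ≤ b) (hb : 0 ≤ b) :
    extRatio a s ≤ ENNReal.ofReal (b / r) := by
  have hs0 : 0 < s := hr.trans_le hs
  rw [extRatio, if_neg hs0.ne']
  refine ENNReal.ofReal_le_ofReal ?_
  exact div_le_div₀ hb hab hr hs

/-- Near a matrix with positive restricted singular value the condition number is bounded, and the
Gaussian law charges every nonempty open set. -/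
theorem exists_gaussianMatrix_renegarCond_lt {C : ClosedConvexCone m} {D : ClosedConvexCone n}
    (hC : C ≠ ⊥) (hD : D ≠ ⊥) :
    ∃ M : ℝ, gaussianMatrix n m {A | ENNReal.ofReal M < renegarCond C D A} < 1 := by
  have main : ∀ f : Matrix (Fin n) (Fin m) ℝ → ℝ, Continuous f →
      (∀ A, renegarCond C D A ≤ extRatio (matOpNorm A) (f A)) → (∃ A, 0 < f A) →
      ∃ M : ℝ, gaussianMatrix n m {A | ENNReal.ofReal M < renegarCond C D A} < 1 := by
    rintro f hf hle ⟨A, hA⟩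
    set U : Set (Matrix (Fin n) (Fin m) ℝ) := {B | f A / 2 < f B ∧ matOpNorm B < matOpNorm A + 1}
      with hU
    have hUo : IsOpen U := (isOpen_lt continuous_const hf).inter
      (isOpen_lt continuous_matOpNorm continuous_const)
    have hUne : U.Nonempty := ⟨A, half_lt_self hA, lt_add_one _⟩
    have hUpos := hUo.measure_pos (gaussianMatrix n m) hUne
    have hA0 : 0 ≤ matOpNorm A := norm_nonneg _
    refine ⟨(matOpNorm A + 1) / (f A / 2), ?_⟩
    have hsub : {B | ENNReal.ofReal ((matOpNorm A + 1) / (f A / 2)) < renegarCond C D B} ⊆ Uᶜ := by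
      intro B hB hBU
      refine absurd hB (not_lt.2 ((hle B).trans ?_))
      exact extRatio_le (by positivity) hBU.1.le hBU.2.le (by positivity)
    refine (measure_mono hsub).trans_lt ?_
    rw [prob_compl_eq_one_sub hUo.measurableSet]
    exact ENNReal.sub_lt_self ENNReal.one_ne_top one_ne_zero hUpos.ne'
  obtain ⟨A, hA | hA⟩ := exists_sres_pos hC hD
  · exact main (fun A => sres A C D) (continuous_sres hC D) (fun A => min_le_left _ _) ⟨A, hA⟩
  · exact main (fun A => sres (-A.transpose) D C)
      ((continuous_sres hD C).comp continuous_id.matrix_transpose.neg)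
      (fun A => min_le_right _ _) ⟨A, hA⟩

end WellConditioned

/-! ### Bounds for expectations conditioned off a set -/

section ConditionalExpectation

variable {Ω : Type*} [MeasurableSpace Ω] {μ : Measure Ω}

theorem condExpOff_le {T : Ω → ℝ≥0∞} {E : Set Ω} (hE : MeasurableSet E) {a : ℝ≥0∞}
    (ha : ∀ x, x ∉ E → T x ≤ a) : condExpOff μ T E ≤ a := by
  rw [condExpOff]
  calc ∫⁻ x, T x ∂(cond μ Eᶜ) ≤ ∫⁻ _, a ∂(cond μ Eᶜ) :=
        lintegral_mono_ae (ae_cond_of_forall_mem hE.compl fun x hx => ha x hx)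
    _ = a * cond μ Eᶜ Set.univ := lintegral_const _
    _ ≤ a * 1 := mul_le_mul_right prob_le_one _
    _ = a := mul_one a

/-- A coarse bound `b` off `E` and a sharp bound `a` off `E ∪ B`: the coarse one only costs the
conditional probability of `B`, at most doubled since `Eᶜ` has measure at least one half. -/
theorem condExpOff_le_add [IsProbabilityMeasure μ] {T : Ω → ℝ≥0∞} {E B : Set Ω}
    (hE : MeasurableSet E) (hB : MeasurableSet B) {a b : ℝ≥0∞} (ha : ∀ x, x ∉ E → x ∉ B → T x ≤ a)
    (hb : ∀ x, x ∉ E → T x ≤ b) (hE2 : μ E ≤ 1 / 2) :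
    condExpOff μ T E ≤ a + b * (2 * μ B) := by
  have hEc : (1 / 2 : ℝ≥0∞) ≤ μ Eᶜ := by
    rw [prob_compl_eq_one_sub hE]
    refine ENNReal.le_sub_of_add_le_right (measure_ne_top _ _) ?_
    calc (1 / 2 : ℝ≥0∞) + μ E ≤ 1 / 2 + 1 / 2 := by gcongr
      _ = 1 := ENNReal.add_halves 1
  have hcB : cond μ Eᶜ B ≤ 2 * μ B := by
    rw [cond_apply hE.compl]
    refine mul_le_mul' ?_ (measure_mono Set.inter_subset_right)
    rw [ENNReal.inv_le_iff_inv_le]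
    simpa using hEc
  rw [condExpOff]
  calc ∫⁻ x, T x ∂(cond μ Eᶜ) ≤ ∫⁻ x, (a + B.indicator (fun _ => b) x) ∂(cond μ Eᶜ) := by
        refine lintegral_mono_ae (ae_cond_of_forall_mem hE.compl fun x hx => ?_)
        by_cases hxB : x ∈ B
        · rw [Set.indicator_of_mem hxB]
          exact (hb x hx).trans le_add_self
        · rw [Set.indicator_of_notMem hxB, add_zero]
          exact ha x hx hxB
    _ = a * cond μ Eᶜ Set.univ + b * cond μ Eᶜ B := by
        rw [lintegral_add_left measurable_const, lintegral_const, lintegral_indicator_const hB]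
    _ ≤ a * 1 + b * (2 * μ B) :=
        add_le_add (mul_le_mul_right prob_le_one _) (mul_le_mul_right hcB _)
    _ = a + b * (2 * μ B) := by rw [mul_one]

end ConditionalExpectation

/-! ### Exponential estimates and the sharp limit -/

section Asymptotics

open Real

/-- For a single pair of cones any measure `p < 1` is at most `exp (-(c * n))` with `c = (1 - p) /
n`, by `1 - x ≤ exp (-x)`. This serves the finitely many `k` not covered by the asymptotics. -/
theorem exists_exceptional_set {n m : ℕ} {C : ClosedConvexCone m} {D : ClosedConvexCone n}
    (hC : C ≠ ⊥) (hD : D ≠ ⊥) :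
    ∃ (E : Set (Matrix (Fin n) (Fin m) ℝ)) (c : ℝ), 0 < c ∧ MeasurableSet E ∧
      gaussianMatrix n m E ≤ ENNReal.ofReal (exp (-(c * n))) ∧
      condExpOff (gaussianMatrix n m) (renegarCond C D) E < ∞ := by
  obtain ⟨M, hM⟩ := exists_gaussianMatrix_renegarCond_lt hC hD
  set E := {A | ENNReal.ofReal M < renegarCond C D A} with hE
  have hEm : MeasurableSet E := measurableSet_lt measurable_const (measurable_renegarCond hC hD)
  have hn : (0 : ℝ) < n := by exact_mod_cast pos_of_cone_ne_bot hD
  set p := (gaussianMatrix n m E).toReal with hp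
  have hp1 : p < 1 := by
    have := ENNReal.toReal_strict_mono ENNReal.one_ne_top hM
    simpa using this
  refine ⟨E, (1 - p) / n, div_pos (by linarith) hn, hEm, ?_, ?_⟩
  · rw [← ENNReal.ofReal_toReal (measure_ne_top (gaussianMatrix n m) E), div_mul_cancel₀ _ hn.ne']
    refine ENNReal.ofReal_le_ofReal ?_
    have := one_sub_le_exp_neg (1 - p)
    linarith
  · refine (condExpOff_le hEm (a := ENNReal.ofReal M) fun x hx => ?_).trans_lt
      ENNReal.ofReal_lt_top
    exact not_lt.1 hx

theorem exists_pos_le_of_lt (c : ℕ → ℝ) (hc : ∀ k, 0 < c k) (N : ℕ) :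
    ∃ r, 0 < r ∧ ∀ k < N, r ≤ c k := by
  induction N with
  | zero => exact ⟨1, one_pos, fun k hk => absurd hk (Nat.not_lt_zero k)⟩
  | succ N ih =>
    obtain ⟨r, hr, h⟩ := ih
    refine ⟨min r (c N), lt_min hr (hc N), fun k hk => ?_⟩
    rcases Nat.lt_succ_iff_lt_or_eq.1 hk with h1 | rfl
    · exact (min_le_left _ _).trans (h k h1)
    · exact min_le_right _ _

theorem tendsto_sqrt_div {a b : ℕ → ℝ} {r : ℝ} (hr : 0 ≤ r) (hb : ∀ k, 0 ≤ b k)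
    (h : Tendsto (fun k => a k / b k) atTop (𝓝 (r ^ 2))) :
    Tendsto (fun k => √(a k) / √(b k)) atTop (𝓝 r) := by
  have h1 := (continuous_sqrt.tendsto _).comp h
  rw [sqrt_sq hr] at h1
  refine h1.congr fun k => ?_
  simp only [Function.comp]
  rw [sqrt_div' _ (hb k)]

section

variable {m n : ℕ → ℕ} {C : ∀ k, ClosedConvexCone (m k)} {D : ∀ k, ClosedConvexCone (n k)}
  {α β γ : ℝ}

/-- After division by `√n`, `√δ(D)` and `√δ(C)` tend to `β` and `α * γ`, and the additive constant
disappears. Half of `ε` absorbs these errors and the other half is the deviation `t`. -/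
theorem eventually_gaussianMatrix_sres_le (hC : ∀ k, C k ≠ ⊥) (hD : ∀ k, D k ≠ ⊥)
    (hα : 0 < α) (hβ : 0 < β) (hγ : 0 < γ)
    (hδC : Tendsto (fun k => statDim (C k) / (m k : ℝ)) atTop (𝓝 (α ^ 2)))
    (hδD : Tendsto (fun k => statDim (D k) / (n k : ℝ)) atTop (𝓝 (β ^ 2)))
    (hmn : Tendsto (fun k => (m k : ℝ) / (n k : ℝ)) atTop (𝓝 (γ ^ 2)))
    (hn : Tendsto n atTop atTop) {ε : ℝ} (hε : 0 < ε) :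
    ∃ c : ℝ, 0 < c ∧ ∀ᶠ k in atTop, gaussianMatrix (n k) (m k) {A | matOpNorm A ≤ 4 * √(n k) ∧
      sres A (C k) (D k) ≤ (β - α * γ - ε) * √(n k)} ≤ ENNReal.ofReal (exp (-(c * n k))) := by
  have hn0 : ∀ k, (0 : ℝ) < n k := fun k => by exact_mod_cast pos_of_cone_ne_bot (hD k)
  have hm0 : ∀ k, (0 : ℝ) < m k := fun k => by exact_mod_cast pos_of_cone_ne_bot (hC k)
  have hsn : Tendsto (fun k => √(n k : ℝ)) atTop atTop :=
    tendsto_sqrt_atTop.comp (tendsto_natCast_atTop_atTop.comp hn)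
  have h1 : Tendsto (fun k => √(statDim (D k)) / √(n k : ℝ)) atTop (𝓝 β) :=
    tendsto_sqrt_div hβ.le (fun k => (hn0 k).le) hδD
  have h2 : Tendsto (fun k => √(statDim (C k)) / √(n k : ℝ)) atTop (𝓝 (α * γ)) := by
    refine tendsto_sqrt_div (by positivity) (fun k => (hn0 k).le) ?_
    rw [mul_pow]
    refine (hδC.mul hmn).congr fun k => ?_
    have := (hm0 k).ne'
    have := (hn0 k).ne'
    field_simp
  have h3 : Tendsto (fun k => (projDeviation + 5) / √(n k : ℝ)) atTop (𝓝 0) :=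
    tendsto_const_nhds.div_atTop hsn
  have h4 := (h1.sub h2).sub h3
  rw [sub_zero] at h4
  have h5 := h4.eventually (lt_mem_nhds (by linarith : β - α * γ - ε / 2 < β - α * γ))
  refine ⟨2 * (ε / 2) ^ 2 / π ^ 2, by positivity, h5.mono fun k hk => ?_⟩
  have hs0 : 0 < √(n k : ℝ) := sqrt_pos.2 (hn0 k)
  have ht : 0 ≤ ε / 2 * √(n k : ℝ) := by positivity
  have hM : 0 < 4 * √(n k : ℝ) := by positivity
  have key := gaussianMatrix_sres_le (hC k) (hD k) hM ht
  rw [mul_pow, sq_sqrt (hn0 k).le] at key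
  have e : 2 * ((ε / 2) ^ 2 * (n k : ℝ)) / π ^ 2 = 2 * (ε / 2) ^ 2 / π ^ 2 * n k := by ring
  rw [e] at key
  refine (measure_mono ?_).trans key
  rintro A ⟨hA1, hA2⟩
  refine ⟨hA1, hA2.trans ?_⟩
  rw [← sub_div, ← sub_div, lt_div_iff₀ hs0] at hk
  linarith

theorem eventually_gaussianMatrix_lt_matOpNorm (hn0 : ∀ k, 0 < n k) (hm0 : ∀ k, 0 < m k)
    (hγ : 0 < γ) (hmn : Tendsto (fun k => (m k : ℝ) / (n k : ℝ)) atTop (𝓝 (γ ^ 2)))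
    (hn : Tendsto n atTop atTop) {ε : ℝ} (hε : 0 < ε) :
    ∃ c : ℝ, 0 < c ∧ ∀ᶠ k in atTop, gaussianMatrix (n k) (m k)
      {A | (1 + γ + ε) * √(n k) < matOpNorm A} ≤ ENNReal.ofReal (exp (-(c * n k))) := by
  have hn0' : ∀ k, (0 : ℝ) < n k := fun k => by exact_mod_cast hn0 k
  have hsn : Tendsto (fun k => √(n k : ℝ)) atTop atTop :=
    tendsto_sqrt_atTop.comp (tendsto_natCast_atTop_atTop.comp hn)
  have h1 : Tendsto (fun k => √(m k : ℝ) / √(n k : ℝ)) atTop (𝓝 γ) :=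
    tendsto_sqrt_div hγ.le (fun k => (hn0' k).le) hmn
  have h3 : Tendsto (fun k => 2 / √(n k : ℝ)) atTop (𝓝 0) :=
    tendsto_const_nhds.div_atTop hsn
  have h4 := h1.add h3
  rw [add_zero] at h4
  have h5 := h4.eventually (gt_mem_nhds (by linarith : γ < γ + ε / 2))
  refine ⟨2 * (ε / 2) ^ 2 / π ^ 2, by positivity, h5.mono fun k hk => ?_⟩
  have hs0 : 0 < √(n k : ℝ) := sqrt_pos.2 (hn0' k)
  have ht : 0 ≤ ε / 2 * √(n k : ℝ) := by positivity
  have key := gaussianMatrix_lt_matOpNorm (hn0 k) (hm0 k) ht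
  rw [mul_pow, sq_sqrt (hn0' k).le] at key
  have e : 2 * ((ε / 2) ^ 2 * (n k : ℝ)) / π ^ 2 = 2 * (ε / 2) ^ 2 / π ^ 2 * n k := by ring
  rw [e] at key
  refine (measure_mono ?_).trans key
  intro A hA
  simp only [Set.mem_ofPred_eq] at hA ⊢
  rw [← add_div, div_lt_iff₀ hs0] at hk
  linarith

theorem eventually_measure_union_le {M : ℕ → Type*} [∀ k, MeasurableSpace (M k)]
    {μ : ∀ k, Measure (M k)} {S T : ∀ k, Set (M k)} (hn : Tendsto n atTop atTop)
    (hS : ∃ c : ℝ, 0 < c ∧ ∀ᶠ k in atTop, μ k (S k) ≤ ENNReal.ofReal (exp (-(c * n k))))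
    (hT : ∃ c : ℝ, 0 < c ∧ ∀ᶠ k in atTop, μ k (T k) ≤ ENNReal.ofReal (exp (-(c * n k)))) :
    ∃ c : ℝ, 0 < c ∧ ∀ᶠ k in atTop,
      μ k (S k ∪ T k) ≤ ENNReal.ofReal (exp (-(c * n k))) := by
  obtain ⟨c, hc, hS⟩ := hS
  obtain ⟨d, hd, hT⟩ := hT
  have hr : 0 < min c d := lt_min hc hd
  have hn' : Tendsto (fun k => min c d / 2 * (n k : ℝ)) atTop atTop :=
    (tendsto_natCast_atTop_atTop.comp hn).const_mul_atTop (by positivity)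
  -- Halving the rate absorbs the factor `2` of the union bound once `n k` is large.
  refine ⟨min c d / 2, by positivity, ?_⟩
  filter_upwards [hS, hT, hn'.eventually_ge_atTop 1] with k h1 h2 h3
  have hnk : (0 : ℝ) ≤ n k := Nat.cast_nonneg _
  have e1 : exp (-(c * n k)) ≤ exp (-(min c d * n k)) := by
    gcongr
    exact min_le_left _ _
  have e2 : exp (-(d * n k)) ≤ exp (-(min c d * n k)) := by
    gcongr
    exact min_le_right _ _
  calc μ k (S k ∪ T k) ≤ μ k (S k) + μ k (T k) := measure_union_le _ _
    _ ≤ ENNReal.ofReal (exp (-(min c d * n k))) + ENNReal.ofReal (exp (-(min c d * n k))) :=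
        add_le_add (h1.trans (ENNReal.ofReal_le_ofReal e1)) (h2.trans (ENNReal.ofReal_le_ofReal e2))
    _ = ENNReal.ofReal (2 * exp (-(min c d * n k))) := by
        rw [← ENNReal.ofReal_add (exp_pos _).le (exp_pos _).le, two_mul]
    _ ≤ _ := by
        refine ENNReal.ofReal_le_ofReal ?_
        have e3 : -(min c d * (n k : ℝ)) = -(min c d / 2 * n k) + -(min c d / 2 * n k) := by ring
        have e4 : exp (-(min c d / 2 * n k)) ≤ exp (-1) := exp_le_exp.2 (neg_le_neg h3)
        have e5 : exp (-1) ≤ 1 / 2 := by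
          rw [exp_neg, ← one_div]
          have := add_one_le_exp (1 : ℝ)
          exact one_div_le_one_div_of_le two_pos (by linarith)
        rw [e3, exp_add]
        nlinarith [exp_pos (-(min c d / 2 * (n k : ℝ)))]

/-- Exceptional sets of exponentially small measure, with the asymptotically sharp bound for the
conditional expectation of Renegar's condition number off them. -/
theorem exists_exceptional_sets_eventually (hC : ∀ k, C k ≠ ⊥) (hD : ∀ k, D k ≠ ⊥)
    (hα : 0 < α) (hβ : 0 < β) (hγ : 0 < γ) (hγ1 : γ ≤ 1)
    (hδC : Tendsto (fun k => statDim (C k) / (m k : ℝ)) atTop (𝓝 (α ^ 2)))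
    (hδD : Tendsto (fun k => statDim (D k) / (n k : ℝ)) atTop (𝓝 (β ^ 2)))
    (hmn : Tendsto (fun k => (m k : ℝ) / (n k : ℝ)) atTop (𝓝 (γ ^ 2)))
    (hαβγ : α * γ < β) (hn : Tendsto n atTop atTop) :
    ∃ (E : ∀ k, Set (Matrix (Fin (n k)) (Fin (m k)) ℝ)) (c : ℝ), 0 < c ∧
      (∀ k, MeasurableSet (E k)) ∧
      (∀ᶠ k in atTop, gaussianMatrix (n k) (m k) (E k) ≤ ENNReal.ofReal (exp (-(c * n k)))) ∧
      ∀ η : ℝ, 0 < η → ∀ᶠ k in atTop,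
        condExpOff (gaussianMatrix (n k) (m k)) (renegarCond (C k) (D k)) (E k) ≤
          ENNReal.ofReal ((1 + γ) / (β - α * γ) + η) := by
  have hn0 : ∀ k, 0 < n k := fun k => pos_of_cone_ne_bot (hD k)
  have hm0 : ∀ k, 0 < m k := fun k => pos_of_cone_ne_bot (hC k)
  have hs0 : ∀ k, 0 < √(n k : ℝ) := fun k => sqrt_pos.2 (by exact_mod_cast hn0 k)
  set Δ := β - α * γ with hΔ
  have hΔ0 : 0 < Δ := sub_pos.2 hαβγ
  let S : ℝ → ∀ k, Set (Matrix (Fin (n k)) (Fin (m k)) ℝ) := fun ε k =>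
    {A | matOpNorm A ≤ 4 * √(n k) ∧ sres A (C k) (D k) ≤ (Δ - ε) * √(n k)}
  let T : ℝ → ∀ k, Set (Matrix (Fin (n k)) (Fin (m k)) ℝ) := fun ε k =>
    {A | (1 + γ + ε) * √(n k) < matOpNorm A}
  have hSm : ∀ ε k, MeasurableSet (S ε k) := fun ε k =>
    (measurableSet_le continuous_matOpNorm.measurable measurable_const).inter
      (measurableSet_le (continuous_sres (hC k) (D k)).measurable measurable_const)
  have hTm : ∀ ε k, MeasurableSet (T ε k) := fun ε k =>
    measurableSet_lt measurable_const continuous_matOpNorm.measurable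
  have hST : ∀ ε ε' : ℝ, 0 < ε → 0 < ε' → ∃ c : ℝ, 0 < c ∧ ∀ᶠ k in atTop,
      gaussianMatrix (n k) (m k) (S ε k ∪ T ε' k) ≤ ENNReal.ofReal (exp (-(c * n k))) :=
    fun ε ε' hε hε' => eventually_measure_union_le hn
      (eventually_gaussianMatrix_sres_le hC hD hα hβ hγ hδC hδD hmn hn hε)
      (eventually_gaussianMatrix_lt_matOpNorm hn0 hm0 hγ hmn hn hε')
  have hsmall : ∀ c : ℝ, 0 < c → Tendsto (fun k => exp (-(c * n k))) atTop (𝓝 0) := by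
    intro c hc
    exact tendsto_exp_neg_atTop_nhds_zero.comp
      ((tendsto_natCast_atTop_atTop.comp hn).const_mul_atTop hc)
  have hbound : ∀ ε ε' : ℝ, ε < Δ → 0 < ε' → ∀ k A, A ∉ S ε k → matOpNorm A ≤ 4 * √(n k) →
      A ∉ T ε' k → renegarCond (C k) (D k) A ≤ ENNReal.ofReal ((1 + γ + ε') / (Δ - ε)) := by
    intro ε ε' hε hε' k A hAS hA4 hAT
    have h1 : (Δ - ε) * √(n k) ≤ sres A (C k) (D k) := by
      by_contra! h
      exact hAS ⟨hA4, h.le⟩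
    have h2 : matOpNorm A ≤ (1 + γ + ε') * √(n k) := not_lt.1 hAT
    refine (min_le_left _ _).trans ((extRatio_le
      (mul_pos (sub_pos.2 hε) (hs0 k)) h1 h2 (by positivity)).trans (le_of_eq ?_))
    rw [mul_div_mul_right _ _ (hs0 k).ne']
  -- The exceptional sets do not depend on `η`: any `ε < Δ` keeps the condition number bounded. Off
  -- them the norm is at most `(2 + γ) √n`, below `4 √n` because `γ ≤ 1`.
  obtain ⟨c, hc, hE⟩ := hST (Δ / 2) 1 (by positivity) one_pos
  have h4 : ∀ k A, A ∉ S (Δ / 2) k ∪ T 1 k → matOpNorm A ≤ 4 * √(n k) := by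
    intro k A hA
    have h1 : matOpNorm A ≤ (1 + γ + 1) * √(n k) := not_lt.1 fun h => hA (Or.inr h)
    nlinarith [hs0 k]
  refine ⟨fun k => S (Δ / 2) k ∪ T 1 k, c, hc, fun k => (hSm _ k).union (hTm _ k), hE,
    fun η hη => ?_⟩
  obtain ⟨ε, hε0, hεΔ, hεη⟩ : ∃ ε : ℝ, 0 < ε ∧ ε < Δ ∧
      (1 + γ + ε) / (Δ - ε) < (1 + γ) / Δ + η / 2 := by
    have hcont : Tendsto (fun ε : ℝ => (1 + γ + ε) / (Δ - ε)) (𝓝[>] 0) (𝓝 ((1 + γ) / Δ)) := by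
      have : ContinuousAt (fun ε : ℝ => (1 + γ + ε) / (Δ - ε)) 0 :=
        ContinuousAt.div (by fun_prop) (by fun_prop) (by simpa using hΔ0.ne')
      have h := this.tendsto
      simp only [add_zero, sub_zero] at h
      exact h.mono_left nhdsWithin_le_nhds
    have e1 := hcont.eventually (gt_mem_nhds (by linarith : (1 + γ) / Δ < (1 + γ) / Δ + η / 2))
    have e2 : ∀ᶠ ε : ℝ in 𝓝[>] 0, ε < Δ := nhdsWithin_le_nhds (gt_mem_nhds hΔ0)
    have e3 : ∀ᶠ ε : ℝ in 𝓝[>] 0, 0 < ε := self_mem_nhdsWithin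
    obtain ⟨ε, h1, h2, h3⟩ := (e1.and (e2.and e3)).exists
    exact ⟨ε, h3, h2, h1⟩
  -- The rate `c'` depends on `η`, which is harmless: these finer sets enter only through their
  -- vanishing contribution to the expectation.
  obtain ⟨c', hc', hB⟩ := hST ε ε hε0 hε0
  set b := (1 + γ + 1) / (Δ - Δ / 2) with hb
  have hb0 : 0 < b := div_pos (by linarith) (by linarith)
  have hlim : Tendsto (fun k => b * (2 * exp (-(c' * n k)))) atTop (𝓝 0) := by
    simpa using ((hsmall c' hc').const_mul 2).const_mul b
  filter_upwards [hE, hB, (hsmall c hc).eventually (gt_mem_nhds (by norm_num : (0 : ℝ) < 1 / 2)),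
    hlim.eventually (gt_mem_nhds (half_pos hη))] with k hk1 hk2 hk3 hk4
  have hE2 : gaussianMatrix (n k) (m k) (S (Δ / 2) k ∪ T 1 k) ≤ 1 / 2 := by
    refine hk1.trans ((ENNReal.ofReal_le_ofReal hk3.le).trans (le_of_eq ?_))
    rw [ENNReal.ofReal_div_of_pos two_pos]
    simp
  have hcond := condExpOff_le_add (μ := gaussianMatrix (n k) (m k))
    (T := renegarCond (C k) (D k)) ((hSm (Δ / 2) k).union (hTm 1 k))
    ((hSm ε k).union (hTm ε k))
    (fun A hA1 hA2 => hbound ε ε hεΔ hε0 k A (fun h => hA2 (Or.inl h)) (h4 k A hA1)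
      (fun h => hA2 (Or.inr h)))
    (fun A hA => hbound (Δ / 2) 1 (by linarith) one_pos k A (fun h => hA (Or.inl h)) (h4 k A hA)
      (fun h => hA (Or.inr h))) hE2
  refine hcond.trans ?_
  have h2 : ENNReal.ofReal b * (2 * gaussianMatrix (n k) (m k) (S ε k ∪ T ε k)) ≤
      ENNReal.ofReal (η / 2) := by
    calc _ ≤ ENNReal.ofReal b * (ENNReal.ofReal 2 * ENNReal.ofReal (exp (-(c' * n k)))) := by
          rw [ENNReal.ofReal_ofNat]
          gcongr
      _ = ENNReal.ofReal (b * (2 * exp (-(c' * n k)))) := by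
          rw [← ENNReal.ofReal_mul zero_le_two, ← ENNReal.ofReal_mul hb0.le]
      _ ≤ _ := ENNReal.ofReal_le_ofReal hk4.le
  refine (add_le_add (ENNReal.ofReal_le_ofReal hεη.le) h2).trans (le_of_eq ?_)
  rw [← ENNReal.ofReal_add (by positivity) (by positivity)]
  congr 1
  ring

end

end Asymptotics

/-! ### From eventual estimates to all indices -/

/-- Exponential decay in `n k` is exponential decay in `k` when `k = O(n k)`. -/
theorem eventually_exp_neg_le_of_isBigO {n : ℕ → ℕ}
    (h : (fun k : ℕ => (k : ℝ)) =O[atTop] (fun k : ℕ => (n k : ℝ))) {c : ℝ} (hc : 0 < c) :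
    ∃ d : ℝ, 0 < d ∧ ∀ᶠ k : ℕ in atTop, Real.exp (-(c * n k)) ≤ Real.exp (-(d * k)) := by
  obtain ⟨K, hK, h⟩ := h.exists_pos
  refine ⟨c / K, div_pos hc hK, ?_⟩
  filter_upwards [h.bound] with k hk
  simp only [Real.norm_natCast] at hk
  refine Real.exp_le_exp.2 (neg_le_neg ?_)
  calc c / K * k ≤ c / K * (K * n k) := by gcongr
    _ = c * n k := by field_simp

/-- A sequence of extended reals that is finite and eventually exceeds a positive `L` by
arbitrarily little has a strict real majorant that converges to `L`. -/
theorem exists_lt_ofReal_tendsto {a : ℕ → ℝ≥0∞} {L : ℝ} (hL : 0 < L) (ha : ∀ k, a k < ∞)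
    (h : ∀ η : ℝ, 0 < η → ∀ᶠ k in atTop, a k ≤ ENNReal.ofReal (L + η)) :
    ∃ u : ℕ → ℝ, (∀ k, a k < ENNReal.ofReal (u k)) ∧ Tendsto u atTop (𝓝 L) := by
  have hone : ∀ k : ℕ, (0 : ℝ) < 1 / (k + 1) := fun k => Nat.one_div_pos_of_nat
  -- The maximum with `L` gives the lower half of the limit, as `a k` may stay below `L`; the last
  -- term makes the inequality strict.
  refine ⟨fun k => max (a k).toReal L + 1 / (k + 1), fun k => ?_, ?_⟩
  · rw [← ENNReal.ofReal_toReal (ha k).ne,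
      ENNReal.ofReal_lt_ofReal_iff (add_pos (lt_max_of_lt_right hL) (hone k))]
    exact (le_max_left _ L).trans_lt (lt_add_of_pos_right _ (hone k))
  · have hmax : Tendsto (fun k => max (a k).toReal L) atTop (𝓝 L) := by
      rw [tendsto_order]
      refine ⟨fun b hb => Eventually.of_forall fun k => lt_max_of_lt_right hb, fun b hb => ?_⟩
      filter_upwards [h ((b - L) / 2) (half_pos (sub_pos.2 hb))] with k hk
      have := ENNReal.toReal_le_of_le_ofReal (by linarith) hk
      exact max_lt (by linarith) hb
    simpa using hmax.add tendsto_one_div_add_atTop_nhds_zero_nat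

theorem mainTheorem3
    (m n : ℕ → ℕ)
    (C : ∀ k, ClosedConvexCone (m k)) (D : ∀ k, ClosedConvexCone (n k))
    (hC : ∀ k, C k ≠ ⊥) (hD : ∀ k, D k ≠ ⊥)
    (α β γ : ℝ)
    (hα : 0 < α ∧ α ≤ 1) (hβ : 0 < β ∧ β ≤ 1) (hγ : 0 < γ ∧ γ ≤ 1)
    (hδC : Tendsto (fun k => statDim (C k) / (m k : ℝ)) atTop (𝓝 (α ^ 2)))
    (hδD : Tendsto (fun k => statDim (D k) / (n k : ℝ)) atTop (𝓝 (β ^ 2)))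
    (hmn : Tendsto (fun k => (m k : ℝ) / (n k : ℝ)) atTop (𝓝 (γ ^ 2)))
    (hαβγ : α * γ < β)
    (hn : Tendsto n atTop atTop) :
    (∃ (E : ∀ k, Set (Matrix (Fin (n k)) (Fin (m k)) ℝ)) (c : ℝ) (u : ℕ → ℝ),
      0 < c ∧
      (∀ k, MeasurableSet (E k)) ∧
      (∀ k, gaussianMatrix (n k) (m k) (E k) ≤ ENNReal.ofReal (Real.exp (-(c * n k)))) ∧
      (∀ k, condExpOff (gaussianMatrix (n k) (m k)) (renegarCond (C k) (D k)) (E k) <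
        ENNReal.ofReal (u k)) ∧
      Tendsto u atTop (𝓝 ((1 + γ) / (β - α * γ)))) ∧
    ((fun k : ℕ => (k : ℝ)) =O[atTop] (fun k : ℕ => (n k : ℝ)) →
      HasWeakExpectation (fun k => gaussianMatrix (n k) (m k))
        (fun k => renegarCond (C k) (D k)) (fun _ => 1)) := by
  have hfirst : ∃ (E : ∀ k, Set (Matrix (Fin (n k)) (Fin (m k)) ℝ)) (c : ℝ) (u : ℕ → ℝ),
      0 < c ∧ (∀ k, MeasurableSet (E k)) ∧
      (∀ k, gaussianMatrix (n k) (m k) (E k) ≤ ENNReal.ofReal (Real.exp (-(c * n k)))) ∧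
      (∀ k, condExpOff (gaussianMatrix (n k) (m k)) (renegarCond (C k) (D k)) (E k) <
        ENNReal.ofReal (u k)) ∧
      Tendsto u atTop (𝓝 ((1 + γ) / (β - α * γ))) := by
    obtain ⟨E₀, c₀, hc₀, hE₀m, hE₀, hlim⟩ := exists_exceptional_sets_eventually hC hD hα.1 hβ.1
      hγ.1 hγ.2 hδC hδD hmn hαβγ hn
    obtain ⟨N, hN⟩ := eventually_atTop.1 (hE₀.and (hlim 1 one_pos))
    choose E₁ c₁ hc₁ hE₁m hE₁ hfin using fun k => exists_exceptional_set (hC k) (hD k)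
    -- Below `N` the rates depend on `k`, but finitely many positive rates have a positive lower
    -- bound.
    obtain ⟨r, hr, hrN⟩ := exists_pos_le_of_lt c₁ hc₁ N
    have hE_eq : ∀ k, N ≤ k → (if N ≤ k then E₀ k else E₁ k) = E₀ k := fun k hk => if_pos hk
    have hlim' : ∀ η : ℝ, 0 < η → ∀ᶠ k in atTop,
        condExpOff (gaussianMatrix (n k) (m k)) (renegarCond (C k) (D k))
          (if N ≤ k then E₀ k else E₁ k) ≤
          ENNReal.ofReal ((1 + γ) / (β - α * γ) + η) := fun η hη => by
      filter_upwards [hlim η hη, eventually_ge_atTop N] with k hk hNk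
      rwa [hE_eq k hNk]
    have hfin' : ∀ k, condExpOff (gaussianMatrix (n k) (m k)) (renegarCond (C k) (D k))
        (if N ≤ k then E₀ k else E₁ k) < ∞ := fun k => by
      split_ifs with hk
      · exact (hN k hk).2.trans_lt ENNReal.ofReal_lt_top
      · exact hfin k
    obtain ⟨u, hu, hulim⟩ := exists_lt_ofReal_tendsto
      (div_pos (by linarith [hγ.1]) (sub_pos.2 hαβγ)) hfin' hlim'
    refine ⟨_, min c₀ r, u, lt_min hc₀ hr, fun k => ?_, fun k => ?_, hu, hulim⟩
    · split_ifs
      exacts [hE₀m k, hE₁m k]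
    · split_ifs with hk
      · refine (hN k hk).1.trans (ENNReal.ofReal_le_ofReal (Real.exp_le_exp.2 (neg_le_neg ?_)))
        gcongr
        exact min_le_left _ _
      · refine (hE₁ k).trans (ENNReal.ofReal_le_ofReal (Real.exp_le_exp.2 (neg_le_neg ?_)))
        gcongr
        exact (min_le_right _ _).trans (hrN k (not_le.1 hk))
  refine ⟨hfirst, fun hkn => ?_⟩
  obtain ⟨E, c, u, hc, hEm, hE, hu, hulim⟩ := hfirst
  refine ⟨fun k => (measurable_renegarCond (hC k) (hD k)).aemeasurable, E,
    fun k => ⟨hEm k, (hE k).trans_lt ?_⟩, ?_, ?_⟩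
  · have hnk : (0 : ℝ) < n k := by exact_mod_cast pos_of_cone_ne_bot (hD k)
    rw [← ENNReal.ofReal_one, ENNReal.ofReal_lt_ofReal_iff one_pos, Real.exp_lt_one_iff]
    exact neg_neg_of_pos (mul_pos hc hnk)
  · obtain ⟨d, hd, hcd⟩ := eventually_exp_neg_le_of_isBigO hkn hc
    exact ⟨d, hd, hcd.mono fun k hk => (hE k).trans (ENNReal.ofReal_le_ofReal hk)⟩
  · obtain ⟨K, hK⟩ := hulim.bddAbove_range
    refine ⟨max K 1, lt_max_of_lt_right one_pos, fun k => (hu k).le.trans ?_⟩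
    rw [mul_one]
    exact ENNReal.ofReal_le_ofReal ((hK ⟨k, rfl⟩).trans (le_max_left _ _))
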